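/- Let $p$ be a prime, let $d_px$ be the Haar measure on $\mathbb{Q}_p$ with $\int_{\mathbb{Z}_p}d_px=1$, let $|\cdot|_p$ be the $p$-adic norm ($|p|_p=p^{-1}$), and put $$\psi_p(x)=\max(|x|_p,1)\ (x\in\mathbb{Q}_p),\qquad \Gamma_{\mathbb{Q}_p}(s)=\frac{1-p^{-1}}{1-p^{-s}}\ (s\in\mathbb{C}).$$ For $\sigma_1,\sigma_2,\sigma_3\in\mathbb{C}$ let $\nu_1=\sigma_1-\sigma_2-\sigma_3$, $\nu_2=\sigma_2-\sigma_3-\sigma_1$, $\nu_3=\sigma_3-\sigma_1-\sigma_2$, and $$I(\sigma_1,\sigma_2,\sigma_3)=\int_{\mathbb{Q}_p^3}\prod_{i=1}^3\psi_p(x_i)^{-2\sigma_i}\,|x_1-x_2|_p^{-1-\nu_3}|x_2-x_3|_p^{-1-\nu_1}|x_3-x_1|_p^{-1-\nu_2}\,d_px_1d_px_2d_px_3,$$ $$\tilde I(\sigma_1,\sigma_2,\sigma_3)=\int_{\mathbb{Q}_p^2}\psi_p(x_1)^{-2\sigma_1}\psi_p(x_2)^{-2\sigma_2}|x_1-x_2|_p^{-1-\nu_3}\,d_px_1d_px_2.$$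 Each of these two integrals converges absolutely if and only if $\Re\nu_1,\Re\nu_2,\Re\nu_3<0$ and $\Re(\sigma_1+\sigma_2+\sigma_3)>1$, and in that case: (i) $$I(\sigma_1,\sigma_2,\sigma_3)=\frac{1}{\Gamma_{\mathbb{Q}_p}(2)}\,\tilde I(\sigma_1,\sigma_2,\sigma_3),\qquad\text{where}\quad \frac1{\Gamma_{\mathbb{Q}_p}(2)}=1+p^{-1}=\int_{\mathbb{Q}_p}\psi_p(x)^{-2}\,d_px$$ (the last integral being absolutely convergent); (ii) $$\tilde I(\sigma_1,\sigma_2,\sigma_3)=\frac{\Gamma_{\mathbb{Q}_p}(\sigma_1+\sigma_2+\sigma_3-1)\,\Gamma_{\mathbb{Q}_p}(-\nu_1)\Gamma_{\mathbb{Q}_p}(-\nu_2)\Gamma_{\mathbb{Q}_p}(-\nu_3)}{\Gamma_{\mathbb{Q}_p}(2\sigma_1)\Gamma_{\mathbb{Q}_p}(2\sigma_2)\Gamma_{\mathbb{Q}_p}(2\sigma_3)}.$$ Equivalently to (ii), in other parameters: for $a,b,c\in\mathbb{C}$ the integral $$J(a,b,c)=\int_{\mathbb{Q}_p^2}\psi_p(x)^a\psi_p(y)^b|x-y|_p^c\,d_px\,d_py$$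 converges absolutely if and only if the real parts of $c+1$, $-a-c-1$, $-b-c-1$, $-a-b-c-2$ are all positive, and then $$J(a,b,c)=\frac{\Gamma_{\mathbb{Q}_p}(c+1)\Gamma_{\mathbb{Q}_p}(-a-c-1)\Gamma_{\mathbb{Q}_p}(-b-c-1)\Gamma_{\mathbb{Q}_p}(-a-b-c-2)}{\Gamma_{\mathbb{Q}_p}(-a)\Gamma_{\mathbb{Q}_p}(-b)\Gamma_{\mathbb{Q}_p}(-a-b-2c-2)}.$$ -/

import Mathlib

open MeasureTheory

noncomputable section

/-- The field of `p`-adic numbers carries its Borel sigma-algebra. -/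
instance padicMeasurableSpace (p : ℕ) [Fact p.Prime] : MeasurableSpace ℚ_[p] := borel ℚ_[p]

instance padicBorelSpace (p : ℕ) [Fact p.Prime] : BorelSpace ℚ_[p] := ⟨rfl⟩

/-- The ring of integers `{x | |x|_p ≤ 1}` of `ℚ_[p]`, as a compact set with non-empty interior. -/
def padicUnitBall (p : ℕ) [Fact p.Prime] : TopologicalSpace.PositiveCompacts ℚ_[p] where
  carrier := Metric.closedBall 0 1
  isCompact' := isCompact_closedBall 0 1
  interior_nonempty' :=
    ⟨0, Metric.ball_subset_interior_closedBall (Metric.mem_ball_self one_pos)⟩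

/-- The Haar measure `d_p x` on `ℚ_[p]`, normalized so that the ring of integers has measure `1`. -/
def padicHaar (p : ℕ) [Fact p.Prime] : Measure ℚ_[p] :=
  Measure.addHaarMeasure (padicUnitBall p)

instance padicHaar_isAddHaarMeasure (p : ℕ) [Fact p.Prime] : (padicHaar p).IsAddHaarMeasure :=
  Measure.isAddHaarMeasure_addHaarMeasure (padicUnitBall p)

theorem padicHaar_integers (p : ℕ) [Fact p.Prime] : padicHaar p {x : ℚ_[p] | ‖x‖ ≤ 1} = 1 := by
  have h : {x : ℚ_[p] | ‖x‖ ≤ 1} = padicUnitBall p := by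
    ext x
    change ‖x‖ ≤ 1 ↔ x ∈ Metric.closedBall (0 : ℚ_[p]) 1
    simp
  rw [h]
  exact Measure.addHaarMeasure_self

/-- `ψ_p(x) = max(|x|_p, 1)`. -/
def padicPsi {p : ℕ} [Fact p.Prime] (x : ℚ_[p]) : ℝ := max ‖x‖ 1

/-- `Γ_{ℚ_p}(s) = (1 - p⁻¹) / (1 - p^{-s})`. -/
def padicGamma (p : ℕ) (s : ℂ) : ℂ := (1 - (p : ℂ)⁻¹) / (1 - (p : ℂ) ^ (-s))

/-- With this, `ν₁ = zamNu σ₁ σ₂ σ₃`, `ν₂ = zamNu σ₂ σ₃ σ₁` and `ν₃ = zamNu σ₃ σ₁ σ₂`. -/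
def zamNu (s t u : ℂ) : ℂ := s - t - u

/-- The integrand of the triple integral, as a function of `x = (x₁, x₂, x₃)`. -/
def tripleIntegrand (p : ℕ) [Fact p.Prime] (σ₁ σ₂ σ₃ : ℂ) (x : ℚ_[p] × ℚ_[p] × ℚ_[p]) : ℂ :=
  (padicPsi x.1 : ℂ) ^ (-2 * σ₁) * (padicPsi x.2.1 : ℂ) ^ (-2 * σ₂) *
    (padicPsi x.2.2 : ℂ) ^ (-2 * σ₃) *
    (‖x.1 - x.2.1‖ : ℂ) ^ (-1 - zamNu σ₃ σ₁ σ₂) *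
    (‖x.2.1 - x.2.2‖ : ℂ) ^ (-1 - zamNu σ₁ σ₂ σ₃) *
    (‖x.2.2 - x.1‖ : ℂ) ^ (-1 - zamNu σ₂ σ₃ σ₁)

/-- The product Haar measure on `ℚ_p³`. -/
def padicHaar₃ (p : ℕ) [Fact p.Prime] : Measure (ℚ_[p] × ℚ_[p] × ℚ_[p]) :=
  (padicHaar p).prod ((padicHaar p).prod (padicHaar p))

/-- The product Haar measure on `ℚ_p²`. -/
def padicHaar₂ (p : ℕ) [Fact p.Prime] : Measure (ℚ_[p] × ℚ_[p]) :=
  (padicHaar p).prod (padicHaar p)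

/-- The triple integral `I_{ℚ_p}(σ₁, σ₂, σ₃)`. -/
def tripleIntegral (p : ℕ) [Fact p.Prime] (σ₁ σ₂ σ₃ : ℂ) : ℂ :=
  ∫ x, tripleIntegrand p σ₁ σ₂ σ₃ x ∂(padicHaar₃ p)

/-- The integrand of the double integral `J(a, b, c)`. -/
def jIntegrand (p : ℕ) [Fact p.Prime] (a b c : ℂ) (x : ℚ_[p] × ℚ_[p]) : ℂ :=
  (padicPsi x.1 : ℂ) ^ a * (padicPsi x.2 : ℂ) ^ b * (‖x.1 - x.2‖ : ℂ) ^ c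

/-- `J(a, b, c) = ∬ ψ_p(x)^a ψ_p(y)^b |x - y|_p^c`. -/
def jIntegral (p : ℕ) [Fact p.Prime] (a b c : ℂ) : ℂ :=
  ∫ x, jIntegrand p a b c x ∂(padicHaar₂ p)

/-- The integrand of the double integral `Ĩ`, as a function of `x = (x₁, x₂)`. -/
def doubleIntegrand (p : ℕ) [Fact p.Prime] (σ₁ σ₂ σ₃ : ℂ) (x : ℚ_[p] × ℚ_[p]) : ℂ :=
  (padicPsi x.1 : ℂ) ^ (-2 * σ₁) * (padicPsi x.2 : ℂ) ^ (-2 * σ₂) *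
    (‖x.1 - x.2‖ : ℂ) ^ (-1 - zamNu σ₃ σ₁ σ₂)

/-- The double integral `Ĩ_{ℚ_p}(σ₁, σ₂, σ₃)`. -/
def doubleIntegral (p : ℕ) [Fact p.Prime] (σ₁ σ₂ σ₃ : ℂ) : ℂ :=
  ∫ x, doubleIntegrand p σ₁ σ₂ σ₃ x ∂(padicHaar₂ p)

/-- The parameters with `Re ν₁, Re ν₂, Re ν₃ < 0` and `Re (σ₁ + σ₂ + σ₃) > 1`. -/
def ConvergenceDomain (σ₁ σ₂ σ₃ : ℂ) : Prop :=
  (zamNu σ₁ σ₂ σ₃).re < 0 ∧ (zamNu σ₂ σ₃ σ₁).re < 0 ∧ (zamNu σ₃ σ₁ σ₂).re < 0 ∧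
    1 < (σ₁ + σ₂ + σ₃).re

end

/-! Double integral. By the ultrametric inequality, `|x - y|` is `max |x| |y|` unless `|x| = |y|`.
Split `ℚ_p²` according to whether `ψ(x)` is larger than, smaller than or equal to `ψ(y)`. On each
region the slice integral in `x` is a geometric series over spheres. Its value is a constant times
`ψ(y)^(a+b+c+1)`, with a correction on `|y| ≤ 1` in the diagonal case (`slice_outside`,
`slice_diagonal`). Integrating over `y` is one more geometric series. A function is integrable iff
its three restrictions are, so Tonelli on each region gives the exact domain, and `gamma_identity`
adds the three values into a product of Gamma factors.

Triple integral. Since `ν₂ + ν₃ = -2σ₁` and cyclically, the powers of `ψ` are exactly those that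
turn the integrand into a product of powers of the chordal distances `|x - y| / (ψ(x) ψ(y))` against
the measure `ψ(x)⁻² dx` in each variable (`tripleIntegrand_eq`). Distance and measure are both
invariant under `x ↦ x⁻¹` and under translation by `ℤ_p`, and these maps carry infinity to any point
(`exists_measurePreserving_chordal`). Taking `x₁` to be the image of infinity turns its distances to
the other points into `ψ⁻¹`, so the inner integral is `ψ(x₁)⁻²` times a `J` that does not depend on
`x₁`. What remains is `∫ ψ⁻² = 1 + p⁻¹`. -/

noncomputable section

/-! ### Haar measure of balls and spheres -/

section Haar

variable {p : ℕ} [hp : Fact p.Prime]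

theorem prime_cast_pos : (0 : ℝ) < p := by exact_mod_cast hp.out.pos

theorem one_lt_prime_cast : (1 : ℝ) < p := by exact_mod_cast hp.out.one_lt

theorem exists_nat_norm_sub_le {x : ℚ_[p]} (hx : ‖x‖ ≤ 1) :
    ∃ i < p, ‖x - (i : ℚ_[p])‖ ≤ (p : ℝ) ^ (-1 : ℤ) := by
  obtain ⟨y, rfl⟩ : ∃ y : ℤ_[p], (y : ℚ_[p]) = x := ⟨⟨x, hx⟩, rfl⟩
  obtain ⟨i, hi, h⟩ := PadicInt.exists_mem_range y
  refine ⟨i, hi, ?_⟩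
  rw [Padic.norm_le_pow_iff_norm_lt_pow_add_one]
  have := PadicInt.mem_nonunits.1 ((IsLocalRing.mem_maximalIdeal _).1 h)
  rw [PadicInt.norm_def, PadicInt.coe_sub, PadicInt.coe_natCast] at this
  rwa [neg_add_cancel, zpow_zero]

theorem natCast_eq_of_norm_sub_lt_one {i j : ℕ} (hi : i < p) (hj : j < p)
    (h : ‖(i : ℚ_[p]) - j‖ < 1) : i = j := by
  have h' : ‖((i - j : ℤ) : ℚ_[p])‖ < 1 := by push_cast; exact h
  rw [Padic.norm_intCast_lt_one_iff] at h'
  obtain ⟨k, hk⟩ := h'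
  have : k = 0 := by
    have h1 : (p : ℤ) * k < p * 1 := by omega
    have h2 : (p : ℤ) * (-1) < p * k := by omega
    have hp0 : (0 : ℤ) < p := by exact_mod_cast hp.out.pos
    have := lt_of_mul_lt_mul_left h1 hp0.le
    have := lt_of_mul_lt_mul_left h2 hp0.le
    omega
  subst this
  omega

theorem norm_prime_zpow (n : ℤ) : ‖(p : ℚ_[p]) ^ n‖ = (p : ℝ) ^ (-n) := Padic.norm_p_zpow n

/-- This is the decomposition of `ℤ_p` into residue classes mod `p`, rescaled by `p^(-(n+1))`. -/
theorem closedBall_zpow_succ (n : ℤ) :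
    Metric.closedBall (0 : ℚ_[p]) ((p : ℝ) ^ (n + 1)) =
      ⋃ i ∈ Finset.range p,
        Metric.closedBall ((i : ℚ_[p]) * (p : ℚ_[p]) ^ (-(n + 1))) ((p : ℝ) ^ n) := by
  have hp0 : (p : ℝ) ≠ 0 := prime_cast_pos.ne'
  have hq0 : (p : ℚ_[p]) ≠ 0 := by exact_mod_cast hp.out.ne_zero
  ext x
  simp only [Set.mem_iUnion, Finset.mem_range, Metric.mem_closedBall, dist_eq_norm, sub_zero,
    exists_prop]
  have key (y : ℚ_[p]) :
      ‖x - y * (p : ℚ_[p]) ^ (-(n + 1))‖ = ‖x * (p : ℚ_[p]) ^ (n + 1) - y‖ * (p : ℝ) ^ (n + 1) := by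
    have : x - y * (p : ℚ_[p]) ^ (-(n + 1)) =
        (x * (p : ℚ_[p]) ^ (n + 1) - y) * (p : ℚ_[p]) ^ (-(n + 1)) := by
      rw [sub_mul, mul_assoc, ← zpow_add₀ hq0]; simp
    rw [this, norm_mul, norm_prime_zpow, neg_neg]
  have hpos : (0 : ℝ) < (p : ℝ) ^ (n + 1) := zpow_pos prime_cast_pos _
  have hn : (p : ℝ) ^ n = (p : ℝ) ^ (-1 : ℤ) * (p : ℝ) ^ (n + 1) := by
    rw [← zpow_add₀ hp0]; congr 1; ring
  have h0 : ‖x‖ = ‖x * (p : ℚ_[p]) ^ (n + 1)‖ * (p : ℝ) ^ (n + 1) := by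
    simpa using key 0
  constructor
  · intro hx
    rw [h0, mul_le_iff_le_one_left hpos] at hx
    obtain ⟨i, hi, h⟩ := exists_nat_norm_sub_le hx
    exact ⟨i, hi, by rw [key, hn]; gcongr⟩
  · rintro ⟨i, -, h⟩
    rw [key, hn, mul_le_mul_iff_left₀ hpos] at h
    rw [h0, mul_le_iff_le_one_left hpos]
    have h1 : ‖x * (p : ℚ_[p]) ^ (n + 1) - i‖ ≤ 1 :=
      h.trans (by rw [zpow_neg_one]; exact inv_le_one_of_one_le₀ one_lt_prime_cast.le)
    have h2 : ‖(i : ℚ_[p])‖ ≤ 1 := by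
      have := Padic.norm_int_le_one (p := p) i
      simpa using this
    calc _ = ‖(x * (p : ℚ_[p]) ^ (n + 1) - i) + i‖ := by ring_nf
      _ ≤ max _ _ := Padic.nonarchimedean _ _
      _ ≤ 1 := max_le h1 h2

theorem padicHaar_closedBall_center (a : ℚ_[p]) (r : ℝ) :
    padicHaar p (Metric.closedBall a r) = padicHaar p (Metric.closedBall 0 r) := by
  rw [← measure_preimage_add (padicHaar p) a (Metric.closedBall a r)]
  congr 1
  ext x
  simp [dist_eq_norm]

theorem padicHaar_closedBall_zpow_succ (n : ℤ) :
    padicHaar p (Metric.closedBall 0 ((p : ℝ) ^ (n + 1))) =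
      p * padicHaar p (Metric.closedBall 0 ((p : ℝ) ^ n)) := by
  have hq0 : (p : ℚ_[p]) ≠ 0 := by exact_mod_cast hp.out.ne_zero
  rw [closedBall_zpow_succ, measure_biUnion_finset]
  · simp [padicHaar_closedBall_center]
  · intro i hi j hj hij
    refine (IsUltrametricDist.closedBall_eq_or_disjoint _ _ _).resolve_left fun h => hij ?_
    have hmem : (i : ℚ_[p]) * (p : ℚ_[p]) ^ (-(n + 1)) ∈
        Metric.closedBall ((j : ℚ_[p]) * (p : ℚ_[p]) ^ (-(n + 1))) ((p : ℝ) ^ n) := by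
      rw [← h]; exact Metric.mem_closedBall_self (zpow_pos prime_cast_pos _).le
    rw [Metric.mem_closedBall, dist_eq_norm, ← sub_mul, norm_mul, norm_prime_zpow, neg_neg] at hmem
    refine natCast_eq_of_norm_sub_lt_one (p := p) (by simpa using hi) (by simpa using hj) ?_
    have hpos : (0 : ℝ) < (p : ℝ) ^ n := zpow_pos prime_cast_pos _
    rw [zpow_add_one₀ prime_cast_pos.ne', mul_comm ((p : ℝ) ^ n), ← mul_assoc,
      mul_le_iff_le_one_left hpos] at hmem
    have := one_lt_prime_cast (p := p)
    -- Here `‖i - j‖ * p ≤ 1`, which excludes `‖i - j‖ ≥ 1` because `p > 1`.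
    by_contra hcon
    push Not at hcon
    nlinarith
  · exact fun _ _ => Metric.isClosed_closedBall.measurableSet

theorem padicHaar_closedBall (a : ℚ_[p]) (n : ℤ) :
    padicHaar p (Metric.closedBall a ((p : ℝ) ^ n)) = ENNReal.ofReal ((p : ℝ) ^ n) := by
  have hp0 : (p : ℝ) ≠ 0 := prime_cast_pos.ne'
  have hpE : (p : ENNReal) ≠ 0 := by exact_mod_cast hp.out.ne_zero
  have step (n : ℤ) : ENNReal.ofReal ((p : ℝ) ^ (n + 1)) = p * ENNReal.ofReal ((p : ℝ) ^ n) := by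
    rw [zpow_add_one₀ hp0, mul_comm, ENNReal.ofReal_mul (Nat.cast_nonneg _),
      ENNReal.ofReal_natCast]
  rw [padicHaar_closedBall_center]
  induction n using Int.induction_on with
  | zero =>
    have := padicHaar_integers p
    simpa [Metric.closedBall, dist_eq_norm] using this
  | succ n ih => rw [padicHaar_closedBall_zpow_succ, step, ih]
  | pred n ih =>
    have h1 := padicHaar_closedBall_zpow_succ (p := p) (-(n : ℤ) - 1)
    have h2 := step (-(n : ℤ) - 1)
    rw [sub_add_cancel] at h1 h2
    rw [h1, h2] at ih
    exact (ENNReal.mul_right_inj hpE (ENNReal.natCast_ne_top p)).1 ih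

/-- The norm takes no value strictly between `p^(n-1)` and `p^n`, so the sphere is a difference of
two consecutive balls. -/
theorem padicHaar_sphere (n : ℤ) :
    padicHaar p {x | ‖x‖ = (p : ℝ) ^ n} = ENNReal.ofReal ((1 - (p : ℝ)⁻¹) * (p : ℝ) ^ n) := by
  have hp0 : (p : ℝ) ≠ 0 := prime_cast_pos.ne'
  have h : {x : ℚ_[p] | ‖x‖ = (p : ℝ) ^ n} =
      Metric.closedBall 0 ((p : ℝ) ^ n) \ Metric.closedBall 0 ((p : ℝ) ^ (n - 1)) := by
    ext x
    simp only [Set.mem_ofPred_eq, Set.mem_sdiff, Metric.mem_closedBall, dist_zero_right,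
      Padic.norm_le_pow_iff_norm_lt_pow_add_one x (n - 1), sub_add_cancel, not_lt]
    exact le_antisymm_iff
  have hle : (p : ℝ) ^ (n - 1) ≤ (p : ℝ) ^ n :=
    zpow_le_zpow_right₀ one_lt_prime_cast.le (by omega)
  rw [h, measure_sdiff (Metric.closedBall_subset_closedBall hle)
    Metric.isClosed_closedBall.measurableSet.nullMeasurableSet (by simp [padicHaar_closedBall]),
    padicHaar_closedBall, padicHaar_closedBall, ← ENNReal.ofReal_sub _ (zpow_pos prime_cast_pos _).le]
  congr 1
  rw [zpow_sub_one₀ hp0]; ring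

theorem exists_norm_eq_zpow {x : ℚ_[p]} (hx : x ≠ 0) : ∃ n : ℤ, ‖x‖ = (p : ℝ) ^ n :=
  ⟨_, Padic.norm_eq_zpow_neg_valuation hx⟩

end Haar

/-- A function that is constant on countably many pieces and vanishes off them is integrable iff
the corresponding series converges absolutely, and then its integral is the sum of the series. -/
theorem integrable_iff_summable_of_pieces {X : Type*} [MeasurableSpace X] {μ : Measure X}
    {A : ℕ → Set X} (hA : ∀ k, MeasurableSet (A k)) (hd : Pairwise (Function.onFun Disjoint A))
    {w : ℕ → ℝ} (hw0 : ∀ k, 0 ≤ w k) (hw : ∀ k, μ (A k) = ENNReal.ofReal (w k)) {f : X → ℂ}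
    {g : ℕ → ℂ} (hfg : ∀ k, ∀ x ∈ A k, f x = g k) (h0 : ∀ᵐ x ∂μ, x ∉ ⋃ k, A k → f x = 0) :
    (Integrable f μ ↔ Summable fun k => ‖(w k : ℂ) * g k‖) ∧
      (Integrable f μ → ∫ x, f x ∂μ = ∑' k, (w k : ℂ) * g k) := by
  have hU : MeasurableSet (⋃ k, A k) := .iUnion hA
  have hind : (⋃ k, A k).indicator f =ᵐ[μ] f := by
    filter_upwards [h0] with x hx
    by_cases h : x ∈ ⋃ k, A k
    · simp [h]
    · simp [h, hx h]
  have hpiece (k : ℕ) : IntegrableOn f (A k) μ := by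
    refine (integrableOn_congr_fun (g := fun _ => g k) (hfg k) (hA k)).2 ?_
    exact integrableOn_const (by simp [hw])
  have hint (k : ℕ) : ∫ x in A k, f x ∂μ = (w k : ℂ) * g k := by
    rw [setIntegral_congr_fun (hA k) (hfg k), setIntegral_const, Measure.real, hw,
      ENNReal.toReal_ofReal (hw0 k), Complex.real_smul]
  have hintn (k : ℕ) : ∫ x in A k, ‖f x‖ ∂μ = ‖(w k : ℂ) * g k‖ := by
    rw [setIntegral_congr_fun (g := fun _ => ‖g k‖) (hA k) (fun x hx => by simp [hfg k x hx]),
      setIntegral_const, Measure.real, hw, ENNReal.toReal_ofReal (hw0 k), norm_mul]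
    simp [abs_of_nonneg (hw0 k)]
  have hiff : Integrable f μ ↔ IntegrableOn f (⋃ k, A k) μ := by
    rw [← integrable_indicator_iff hU]
    exact (integrable_congr hind).symm
  refine ⟨⟨fun h => ?_, fun h => ?_⟩, fun h => ?_⟩
  · have := (hasSum_integral_iUnion hA hd (hiff.1 h).norm).summable
    simpa only [hintn] using this
  · exact hiff.2 (integrableOn_iUnion_of_summable_integral_norm hpiece (by simpa only [hintn] using h))
  · have := (hasSum_integral_iUnion hA hd (hiff.1 h)).tsum_eq
    simp only [hint] at this
    rw [this, ← integral_indicator hU]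
    exact (integral_congr_ae hind).symm

/-! ### One-variable integrals as geometric series -/

section OneVariable

variable {p : ℕ} [hp : Fact p.Prime]

theorem ofReal_zpow_cpow {r : ℝ} (hr : 0 < r) (n : ℤ) (s : ℂ) :
    ((r ^ n : ℝ) : ℂ) ^ s = ((r : ℂ) ^ s) ^ n := by
  have hr' : (r : ℂ) ≠ 0 := by exact_mod_cast hr.ne'
  have hn : ((r ^ n : ℝ) : ℂ) ≠ 0 := by exact_mod_cast (zpow_pos hr n).ne'
  rw [Complex.cpow_def_of_ne_zero hn, Complex.cpow_def_of_ne_zero hr', ← Complex.exp_int_mul,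
    ← Complex.ofReal_log (zpow_pos hr n).le, ← Complex.ofReal_log hr.le, Real.log_zpow]
  congr 1
  push_cast
  ring

theorem prime_zpow_cpow (n : ℤ) (s : ℂ) : (((p : ℝ) ^ n : ℝ) : ℂ) ^ s = ((p : ℂ) ^ s) ^ n := by
  simpa using ofReal_zpow_cpow (prime_cast_pos (p := p)) n s

theorem prime_cast_complex_ne_zero : (p : ℂ) ≠ 0 := by exact_mod_cast hp.out.ne_zero

theorem prime_cpow_ne_zero (s : ℂ) : (p : ℂ) ^ s ≠ 0 := by
  simp [Complex.cpow_eq_zero_iff, hp.out.ne_zero]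

theorem prime_cpow_add (s t : ℂ) : (p : ℂ) ^ (s + t) = (p : ℂ) ^ s * (p : ℂ) ^ t :=
  Complex.cpow_add _ _ prime_cast_complex_ne_zero

theorem prime_cpow_add_one (s : ℂ) : (p : ℂ) ^ (s + 1) = (p : ℂ) ^ s * p := by
  rw [prime_cpow_add, Complex.cpow_one]

theorem norm_prime_cpow (s : ℂ) : ‖(p : ℂ) ^ s‖ = (p : ℝ) ^ s.re := by
  simpa using Complex.norm_cpow_eq_rpow_re_of_pos (prime_cast_pos (p := p)) s

theorem norm_prime_cpow_lt_one_iff (s : ℂ) : ‖(p : ℂ) ^ s‖ < 1 ↔ s.re < 0 := by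
  rw [norm_prime_cpow, ← Real.rpow_zero (p : ℝ), Real.rpow_lt_rpow_left_iff one_lt_prime_cast]

theorem one_sub_prime_cpow_ne_zero {s : ℂ} (hs : s.re < 0) : 1 - (p : ℂ) ^ s ≠ 0 := by
  intro h
  have h1 := (norm_prime_cpow_lt_one_iff (p := p) s).2 hs
  rw [← sub_eq_zero.1 h, norm_one] at h1
  exact lt_irrefl _ h1

theorem one_sub_inv_prime_pos : (0 : ℝ) < 1 - (p : ℝ)⁻¹ :=
  sub_pos.2 (inv_lt_one_of_one_lt₀ one_lt_prime_cast)

theorem one_sub_inv_prime_ne_zero : (1 - (p : ℂ)⁻¹) ≠ 0 := by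
  have := Complex.ofReal_ne_zero.2 (one_sub_inv_prime_pos (p := p)).ne'
  push_cast at this
  exact this

/-- The volume of the sphere shifts the exponent by one: `|x|^s` integrates over spheres to a
geometric progression of ratio `p^(s+1)`. -/
theorem sphere_weight_mul (n : ℤ) (s : ℂ) :
    (((1 - (p : ℝ)⁻¹) * (p : ℝ) ^ n : ℝ) : ℂ) * (((p : ℝ) ^ n : ℝ) : ℂ) ^ s =
      (1 - (p : ℂ)⁻¹) * ((p : ℂ) ^ (s + 1)) ^ n := by
  rw [prime_zpow_cpow, prime_cpow_add_one, mul_zpow]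
  push_cast
  ring

theorem summable_norm_const_mul_geometric_iff {c t : ℂ} (hc : c ≠ 0) :
    (Summable fun k : ℕ => ‖c * t ^ k‖) ↔ ‖t‖ < 1 := by
  simp only [norm_mul, norm_pow]
  rw [summable_mul_left_iff (norm_ne_zero_iff.2 hc), summable_geometric_iff_norm_lt_one, norm_norm]

theorem measurableSet_norm_eq (r : ℝ) : MeasurableSet {x : ℚ_[p] | ‖x‖ = r} :=
  measurable_norm (measurableSet_singleton r)

theorem disjoint_spheres {e : ℕ → ℤ} (he : Function.Injective e) :
    Pairwise (Function.onFun Disjoint fun k => {x : ℚ_[p] | ‖x‖ = (p : ℝ) ^ e k}) := by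
  intro i j hij
  refine Set.disjoint_left.2 fun x hi hj => hij (he ?_)
  exact zpow_right_injective₀ prime_cast_pos one_lt_prime_cast.ne' (hi.symm.trans hj)

theorem sphere_weight_nonneg (n : ℤ) : 0 ≤ (1 - (p : ℝ)⁻¹) * (p : ℝ) ^ n :=
  mul_nonneg one_sub_inv_prime_pos.le (zpow_pos prime_cast_pos n).le

theorem zpow_lt_zpow_iff_prime {m n : ℤ} : (p : ℝ) ^ m < (p : ℝ) ^ n ↔ m < n :=
  zpow_lt_zpow_iff_right₀ one_lt_prime_cast

theorem zpow_le_zpow_iff_prime {m n : ℤ} : (p : ℝ) ^ m ≤ (p : ℝ) ^ n ↔ m ≤ n :=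
  zpow_le_zpow_iff_right₀ one_lt_prime_cast

theorem integral_norm_cpow_outside (s : ℂ) (m : ℤ) :
    (Integrable ({x : ℚ_[p] | (p : ℝ) ^ m < ‖x‖}.indicator fun x => (‖x‖ : ℂ) ^ s) (padicHaar p) ↔
      (s + 1).re < 0) ∧
    ((s + 1).re < 0 → ∫ x, {x : ℚ_[p] | (p : ℝ) ^ m < ‖x‖}.indicator (fun x => (‖x‖ : ℂ) ^ s) x
        ∂(padicHaar p) =
      (1 - (p : ℂ)⁻¹) * ((p : ℂ) ^ (s + 1)) ^ (m + 1) / (1 - (p : ℂ) ^ (s + 1))) := by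
  have he : Function.Injective fun k : ℕ => m + 1 + (k : ℤ) := fun i j h => by simpa using h
  have key := integrable_iff_summable_of_pieces (μ := padicHaar p)
    (A := fun k : ℕ => {x : ℚ_[p] | ‖x‖ = (p : ℝ) ^ (m + 1 + (k : ℤ))})
    (fun k => measurableSet_norm_eq _) (disjoint_spheres he)
    (fun k => sphere_weight_nonneg _) (fun k => padicHaar_sphere _)
    (f := {x : ℚ_[p] | (p : ℝ) ^ m < ‖x‖}.indicator fun x => (‖x‖ : ℂ) ^ s)
    (g := fun k => (((p : ℝ) ^ (m + 1 + (k : ℤ)) : ℝ) : ℂ) ^ s)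
    (fun k x hx => by
      have hx' : ‖x‖ = (p : ℝ) ^ (m + 1 + (k : ℤ)) := hx
      rw [Set.indicator_of_mem, hx']
      change _ < ‖x‖
      rw [hx', zpow_lt_zpow_iff_prime]; omega)
    (by
      refine .of_forall fun x hx => Set.indicator_of_notMem (fun h => hx ?_) _
      have h' : (p : ℝ) ^ m < ‖x‖ := h
      obtain ⟨n, hn⟩ := exists_norm_eq_zpow (p := p) (x := x)
        (norm_pos_iff.1 ((zpow_pos prime_cast_pos m).trans h'))
      rw [hn, zpow_lt_zpow_iff_prime] at h'
      refine Set.mem_iUnion.2 ⟨(n - m - 1).toNat, ?_⟩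
      change ‖x‖ = _
      rw [hn]; congr 1; omega)
  have hterm (k : ℕ) : (((1 - (p : ℝ)⁻¹) * (p : ℝ) ^ (m + 1 + (k : ℤ)) : ℝ) : ℂ) *
      (((p : ℝ) ^ (m + 1 + (k : ℤ)) : ℝ) : ℂ) ^ s =
      (1 - (p : ℂ)⁻¹) * ((p : ℂ) ^ (s + 1)) ^ (m + 1) * ((p : ℂ) ^ (s + 1)) ^ k := by
    rw [sphere_weight_mul, zpow_add₀ (prime_cpow_ne_zero _), zpow_natCast, mul_assoc]
  simp only [hterm] at key
  rw [summable_norm_const_mul_geometric_iff (mul_ne_zero one_sub_inv_prime_ne_zero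
    (zpow_ne_zero _ (prime_cpow_ne_zero _))), norm_prime_cpow_lt_one_iff] at key
  refine ⟨key.1, fun h => ?_⟩
  rw [key.2 (key.1.2 h), tsum_mul_left,
    tsum_geometric_of_norm_lt_one ((norm_prime_cpow_lt_one_iff _).2 h), div_eq_mul_inv]

theorem integral_norm_cpow_closedBall (s : ℂ) (m : ℤ) :
    (Integrable ({x : ℚ_[p] | ‖x‖ ≤ (p : ℝ) ^ m}.indicator fun x => (‖x‖ : ℂ) ^ s) (padicHaar p) ↔
      0 < (s + 1).re) ∧
    (0 < (s + 1).re → ∫ x, {x : ℚ_[p] | ‖x‖ ≤ (p : ℝ) ^ m}.indicator (fun x => (‖x‖ : ℂ) ^ s) x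
        ∂(padicHaar p) =
      (1 - (p : ℂ)⁻¹) * ((p : ℂ) ^ (s + 1)) ^ m / (1 - (p : ℂ) ^ (-(s + 1)))) := by
  have he : Function.Injective fun k : ℕ => m - (k : ℤ) := fun i j h => by simpa using h
  have key := integrable_iff_summable_of_pieces (μ := padicHaar p)
    (A := fun k : ℕ => {x : ℚ_[p] | ‖x‖ = (p : ℝ) ^ (m - (k : ℤ))})
    (fun k => measurableSet_norm_eq _) (disjoint_spheres he)
    (fun k => sphere_weight_nonneg _) (fun k => padicHaar_sphere _)
    (f := {x : ℚ_[p] | ‖x‖ ≤ (p : ℝ) ^ m}.indicator fun x => (‖x‖ : ℂ) ^ s)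
    (g := fun k => (((p : ℝ) ^ (m - (k : ℤ)) : ℝ) : ℂ) ^ s)
    (fun k x hx => by
      have hx' : ‖x‖ = (p : ℝ) ^ (m - (k : ℤ)) := hx
      rw [Set.indicator_of_mem, hx']
      change ‖x‖ ≤ _
      rw [hx', zpow_le_zpow_iff_prime]; omega)
    (by
      -- The origin lies on no sphere `‖x‖ = p^n`, and `0 ^ s` need not vanish (it is `1` at `s =
      -- 0`), so the origin is discarded as a null set.
      filter_upwards [(measure_eq_zero_iff_ae_notMem (μ := padicHaar p) (s := {0})).1
        (measure_singleton 0)] with x hx0 hx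
      refine Set.indicator_of_notMem (fun h => hx ?_) _
      have h' : ‖x‖ ≤ (p : ℝ) ^ m := h
      obtain ⟨n, hn⟩ := exists_norm_eq_zpow (p := p) (x := x) (by simpa using hx0)
      rw [hn, zpow_le_zpow_iff_prime] at h'
      refine Set.mem_iUnion.2 ⟨(m - n).toNat, ?_⟩
      change ‖x‖ = _
      rw [hn]; congr 1; omega)
  have hterm (k : ℕ) : (((1 - (p : ℝ)⁻¹) * (p : ℝ) ^ (m - (k : ℤ)) : ℝ) : ℂ) *
      (((p : ℝ) ^ (m - (k : ℤ)) : ℝ) : ℂ) ^ s =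
      (1 - (p : ℂ)⁻¹) * ((p : ℂ) ^ (s + 1)) ^ m * ((p : ℂ) ^ (-(s + 1))) ^ k := by
    rw [sphere_weight_mul, zpow_sub₀ (prime_cpow_ne_zero _), zpow_natCast, Complex.cpow_neg,
      inv_pow, mul_assoc, div_eq_mul_inv]
  simp only [hterm] at key
  rw [summable_norm_const_mul_geometric_iff (mul_ne_zero one_sub_inv_prime_ne_zero
    (zpow_ne_zero _ (prime_cpow_ne_zero _))), norm_prime_cpow_lt_one_iff, Complex.neg_re,
    neg_lt_zero] at key
  refine ⟨key.1, fun h => ?_⟩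
  rw [key.2 (key.1.2 h), tsum_mul_left,
    tsum_geometric_of_norm_lt_one ((norm_prime_cpow_lt_one_iff _).2 (by rw [Complex.neg_re]; linarith)),
    div_eq_mul_inv]

theorem padicPsi_pos (x : ℚ_[p]) : 0 < padicPsi x := lt_max_of_lt_right one_pos

theorem padicPsi_of_norm_le_one {x : ℚ_[p]} (hx : ‖x‖ ≤ 1) : padicPsi x = 1 := max_eq_right hx

theorem padicPsi_of_one_lt_norm {x : ℚ_[p]} (hx : 1 < ‖x‖) : padicPsi x = ‖x‖ := max_eq_left hx.le

theorem measurable_padicPsi : Measurable (padicPsi : ℚ_[p] → ℝ) := by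
  unfold padicPsi; fun_prop

/-- The unit ball contributes a bounded function of compact support, so only `|x|^s` on `|x| > 1 =
p^0` decides. -/
theorem integrable_padicPsi_cpow_iff (s : ℂ) :
    Integrable (fun x : ℚ_[p] => (padicPsi x : ℂ) ^ s) (padicHaar p) ↔ (s + 1).re < 0 := by
  have h1 : Integrable ({x : ℚ_[p] | ‖x‖ ≤ 1}.indicator fun _ => (1 : ℂ)) (padicHaar p) := by
    rw [integrable_indicator_iff (measurableSet_le measurable_norm measurable_const)]
    exact integrableOn_const (by simp [padicHaar_integers])
  have h2 := (integral_norm_cpow_outside (p := p) s 0).1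
  refine Iff.trans ?_ ((integrable_add_iff_integrable_right h1).trans h2)
  refine integrable_congr (.of_forall fun x => ?_)
  rcases le_or_gt ‖x‖ 1 with h | h
  · simp [h, not_lt.2 h, padicPsi_of_norm_le_one h]
  · simp [h, not_le.2 h, padicPsi_of_one_lt_norm h]

theorem integral_padicPsi_cpow {s : ℂ} (hs : (s + 1).re < 0) :
    ∫ x : ℚ_[p], (padicPsi x : ℂ) ^ s ∂(padicHaar p) =
      (1 - (p : ℂ)⁻¹ * (p : ℂ) ^ (s + 1)) / (1 - (p : ℂ) ^ (s + 1)) := by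
  have hm : MeasurableSet {x : ℚ_[p] | ‖x‖ ≤ 1} := measurableSet_le measurable_norm measurable_const
  have h1 : Integrable ({x : ℚ_[p] | ‖x‖ ≤ 1}.indicator fun _ => (1 : ℂ)) (padicHaar p) := by
    rw [integrable_indicator_iff hm]
    exact integrableOn_const (by simp [padicHaar_integers])
  have h2 := integral_norm_cpow_outside (p := p) s 0
  have h3 := one_sub_prime_cpow_ne_zero (p := p) hs
  have : (fun x : ℚ_[p] => (padicPsi x : ℂ) ^ s) = fun x =>
      {x : ℚ_[p] | ‖x‖ ≤ 1}.indicator (fun _ => (1 : ℂ)) x +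
      {x : ℚ_[p] | (p : ℝ) ^ (0 : ℤ) < ‖x‖}.indicator (fun x => (‖x‖ : ℂ) ^ s) x := by
    ext x
    rcases le_or_gt ‖x‖ 1 with h | h
    · simp [h, not_lt.2 h, padicPsi_of_norm_le_one h]
    · simp [h, not_le.2 h, padicPsi_of_one_lt_norm h]
  rw [this, integral_add h1 (h2.1.2 hs), h2.2 hs, integral_indicator hm, setIntegral_const,
    Measure.real, padicHaar_integers]
  simp only [ENNReal.toReal_one, one_smul, zero_add, zpow_one]
  field_simp
  ring

end OneVariable

/-! ### The double integral `J(a, b, c)` -/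

section DoubleIntegral

variable {p : ℕ} [hp : Fact p.Prime]

theorem norm_le_padicPsi (x : ℚ_[p]) : ‖x‖ ≤ padicPsi x := le_max_left _ _

theorem one_le_padicPsi (x : ℚ_[p]) : 1 ≤ padicPsi x := le_max_right _ _

theorem exists_padicPsi_eq_zpow (x : ℚ_[p]) : ∃ m : ℕ, padicPsi x = (p : ℝ) ^ (m : ℤ) := by
  rcases le_or_gt ‖x‖ 1 with h | h
  · exact ⟨0, by simp [padicPsi_of_norm_le_one h]⟩
  · obtain ⟨n, hn⟩ := exists_norm_eq_zpow (p := p) (x := x) (norm_pos_iff.1 (one_pos.trans h))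
    have h' := h
    rw [hn, ← zpow_zero (p : ℝ), zpow_lt_zpow_iff_prime] at h'
    exact ⟨n.toNat, by rw [padicPsi_of_one_lt_norm h, hn, Int.toNat_of_nonneg h'.le]⟩

theorem padicPsi_lt_padicPsi_iff {x y : ℚ_[p]} : padicPsi y < padicPsi x ↔ padicPsi y < ‖x‖ := by
  rw [padicPsi, padicPsi, lt_max_iff, or_iff_left (not_lt.2 (le_max_right _ _))]

theorem norm_sub_eq_left {x y : ℚ_[p]} (h : ‖y‖ < ‖x‖) : ‖x - y‖ = ‖x‖ := by
  rw [sub_eq_add_neg, IsUltrametricDist.norm_add_eq_max_of_norm_ne_norm (by simpa using h.ne'),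
    norm_neg, max_eq_left h.le]

theorem padic_norm_sub_le_max (x y : ℚ_[p]) : ‖x - y‖ ≤ max ‖x‖ ‖y‖ := by
  simpa [sub_eq_add_neg] using Padic.nonarchimedean x (-y)

theorem measurable_jIntegrand (a b c : ℂ) : Measurable (jIntegrand p a b c) := by
  have := measurable_padicPsi (p := p)
  unfold jIntegrand
  fun_prop

theorem measurableSet_padicPsi_lt :
    MeasurableSet {z : ℚ_[p] × ℚ_[p] | padicPsi z.2 < padicPsi z.1} :=
  measurableSet_lt (measurable_padicPsi.comp measurable_snd) (measurable_padicPsi.comp measurable_fst)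

theorem measurableSet_padicPsi_gt :
    MeasurableSet {z : ℚ_[p] × ℚ_[p] | padicPsi z.1 < padicPsi z.2} :=
  measurableSet_lt (measurable_padicPsi.comp measurable_fst) (measurable_padicPsi.comp measurable_snd)

theorem measurableSet_padicPsi_eq :
    MeasurableSet {z : ℚ_[p] × ℚ_[p] | padicPsi z.1 = padicPsi z.2} :=
  measurableSet_eq_fun (measurable_padicPsi.comp measurable_fst)
    (measurable_padicPsi.comp measurable_snd)

theorem ofReal_norm_cpow {r : ℝ} (hr : 0 < r) (s : ℂ) :
    ((‖(r : ℂ) ^ s‖ : ℝ) : ℂ) = (r : ℂ) ^ (s.re : ℂ) := by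
  rw [Complex.norm_cpow_eq_rpow_re_of_pos hr, Complex.ofReal_cpow hr.le]

/-- Taking norms amounts to replacing the parameters by their real parts, so the slice formulas also
compute the integrals of norms that Tonelli needs. On `x = y` this can fail: for `c` nonzero and
imaginary, `0 ^ c = 0` but `0 ^ (c.re : ℂ) = 1`. -/
theorem ofReal_norm_jIntegrand (a b c : ℂ) {x y : ℚ_[p]} (h : x ≠ y) :
    ((‖jIntegrand p a b c (x, y)‖ : ℝ) : ℂ) = jIntegrand p a.re b.re c.re (x, y) := by
  simp only [jIntegrand, norm_mul, Complex.ofReal_mul]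
  rw [ofReal_norm_cpow (padicPsi_pos x), ofReal_norm_cpow (padicPsi_pos y),
    ofReal_norm_cpow (norm_pos_iff.2 (sub_ne_zero.2 h))]

theorem ae_ne (y : ℚ_[p]) : ∀ᵐ x ∂(padicHaar p), x ≠ y := by
  filter_upwards [(measure_eq_zero_iff_ae_notMem (μ := padicHaar p) (s := {y})).1
    (measure_singleton y)] with x hx
  simpa using hx

theorem ofReal_norm_indicator_jIntegrand (S : Set (ℚ_[p] × ℚ_[p])) (a b c : ℂ) (y : ℚ_[p]) :
    ∀ᵐ x ∂(padicHaar p), ((‖S.indicator (jIntegrand p a b c) (x, y)‖ : ℝ) : ℂ) =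
      S.indicator (jIntegrand p a.re b.re c.re) (x, y) := by
  filter_upwards [ae_ne y] with x hx
  by_cases h : (x, y) ∈ S
  · simp only [Set.indicator_of_mem h, ofReal_norm_jIntegrand a b c hx]
  · simp [Set.indicator_of_notMem h]

theorem integrable_complex_ofReal_iff {X : Type*} [MeasurableSpace X] {μ : Measure X} {f : X → ℝ} :
    Integrable (fun x => (f x : ℂ)) μ ↔ Integrable f μ :=
  ⟨fun h => by simpa using h.re, fun h => h.ofReal⟩

/-- Integrability on a product, with the integral of the norm given by a complex function. -/
theorem integrable_prod_iff_of_ofReal_norm {X Y : Type*} [MeasurableSpace X] [MeasurableSpace Y]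
    {μ : Measure X} {ν : Measure Y} [SFinite μ] [SFinite ν] {f g : X × Y → ℂ}
    (hf : AEStronglyMeasurable f (μ.prod ν))
    (h : ∀ y, ∀ᵐ x ∂μ, ((‖f (x, y)‖ : ℝ) : ℂ) = g (x, y)) :
    Integrable f (μ.prod ν) ↔
      (∀ᵐ y ∂ν, Integrable (fun x => f (x, y)) μ) ∧ Integrable (fun y => ∫ x, g (x, y) ∂μ) ν := by
  rw [integrable_prod_iff' hf, ← integrable_complex_ofReal_iff (μ := ν)]
  have : (fun y => ((∫ x, ‖f (x, y)‖ ∂μ : ℝ) : ℂ)) = fun y => ∫ x, g (x, y) ∂μ := by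
    ext y
    rw [← integral_complex_ofReal]
    exact integral_congr_ae (h y)
  rw [this]

/-- If `ψ(y) < ψ(x)`, then `ψ(x) = |x| = |x - y|`, so the slice is `ψ(y)^b |x|^(a+c)` on `|x| >
ψ(y)`. -/
theorem slice_outside (a b c : ℂ) (y : ℚ_[p]) :
    (Integrable (fun x => {z : ℚ_[p] × ℚ_[p] | padicPsi z.2 < padicPsi z.1}.indicator
      (jIntegrand p a b c) (x, y)) (padicHaar p) ↔ (a + c + 1).re < 0) ∧
    ((a + c + 1).re < 0 →
      ∫ x, {z : ℚ_[p] × ℚ_[p] | padicPsi z.2 < padicPsi z.1}.indicator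
        (jIntegrand p a b c) (x, y) ∂(padicHaar p) =
      (1 - (p : ℂ)⁻¹) * (p : ℂ) ^ (a + c + 1) / (1 - (p : ℂ) ^ (a + c + 1)) *
        (padicPsi y : ℂ) ^ (a + b + c + 1)) := by
  obtain ⟨m, hm⟩ := exists_padicPsi_eq_zpow y
  have hψ : (padicPsi y : ℂ) ≠ 0 := by exact_mod_cast (padicPsi_pos y).ne'
  have hs : (fun x => {z : ℚ_[p] × ℚ_[p] | padicPsi z.2 < padicPsi z.1}.indicator
      (jIntegrand p a b c) (x, y)) = fun x => (padicPsi y : ℂ) ^ b *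
        {x : ℚ_[p] | (p : ℝ) ^ (m : ℤ) < ‖x‖}.indicator (fun x => (‖x‖ : ℂ) ^ (a + c)) x := by
    ext x
    by_cases h : padicPsi y < ‖x‖
    · have hx : 0 < ‖x‖ := (padicPsi_pos y).trans h
      simp only [Set.indicator, Set.mem_ofPred_eq]
      rw [if_pos (padicPsi_lt_padicPsi_iff.2 h), if_pos (hm ▸ h), jIntegrand,
        padicPsi_of_one_lt_norm ((one_le_padicPsi y).trans_lt h),
        norm_sub_eq_left ((norm_le_padicPsi y).trans_lt h),
        Complex.cpow_add _ _ (by exact_mod_cast hx.ne')]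
      ring
    · simp only [Set.indicator, Set.mem_ofPred_eq]
      rw [if_neg (fun h' => h (padicPsi_lt_padicPsi_iff.1 h')), if_neg (hm ▸ h), mul_zero]
  have key := integral_norm_cpow_outside (p := p) (a + c) m
  have hne : (padicPsi y : ℂ) ^ b ≠ 0 := by simp [Complex.cpow_eq_zero_iff, hψ]
  rw [hs]
  refine ⟨(integrable_const_mul_iff (IsUnit.mk0 _ hne) _).trans key.1, fun h => ?_⟩
  rw [integral_const_mul, key.2 h, hm, prime_zpow_cpow, prime_zpow_cpow,
    show a + b + c + 1 = b + (a + c + 1) by ring, prime_cpow_add b, mul_zpow,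
    zpow_add_one₀ (prime_cpow_ne_zero _)]
  ring

/-- The slice condition does not depend on `y`, so holding for almost every `y` means just holding.
The outer integrand is then a nonzero multiple of a power of `ψ`, which gives the second inequality
as an equivalence. -/
theorem integrable_outside_iff (a b c : ℂ) :
    Integrable ({z : ℚ_[p] × ℚ_[p] | padicPsi z.2 < padicPsi z.1}.indicator (jIntegrand p a b c))
      (padicHaar₂ p) ↔ (a + c + 1).re < 0 ∧ (a + b + c + 2).re < 0 := by
  rw [padicHaar₂, integrable_prod_iff_of_ofReal_norm
    ((measurable_jIntegrand a b c).indicator measurableSet_padicPsi_lt).aestronglyMeasurable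
    (ofReal_norm_indicator_jIntegrand _ a b c)]
  simp only [(slice_outside a b c _).1, Filter.eventually_const]
  refine and_congr_right fun h => ?_
  have h' : ((a.re : ℂ) + c.re + 1).re < 0 := by simpa using h
  simp only [(slice_outside (a.re : ℂ) b.re c.re _).2 h']
  rw [integrable_const_mul_iff (IsUnit.mk0 _ (div_ne_zero (mul_ne_zero one_sub_inv_prime_ne_zero
    (prime_cpow_ne_zero _)) (one_sub_prime_cpow_ne_zero h'))), integrable_padicPsi_cpow_iff]
  simp only [Complex.add_re, Complex.ofReal_re, Complex.one_re, Complex.re_ofNat]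
  constructor <;> intro h <;> linarith

theorem integral_outside {a b c : ℂ} (h1 : (a + c + 1).re < 0) (h2 : (a + b + c + 2).re < 0) :
    ∫ z, {z : ℚ_[p] × ℚ_[p] | padicPsi z.2 < padicPsi z.1}.indicator (jIntegrand p a b c) z
      ∂(padicHaar₂ p) =
    (1 - (p : ℂ)⁻¹) * (p : ℂ) ^ (a + c + 1) / (1 - (p : ℂ) ^ (a + c + 1)) *
      ((1 - (p : ℂ)⁻¹ * (p : ℂ) ^ (a + b + c + 2)) / (1 - (p : ℂ) ^ (a + b + c + 2))) := by
  have hi := (integrable_outside_iff (p := p) a b c).2 ⟨h1, h2⟩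
  have he : a + b + c + 2 = a + b + c + 1 + 1 := by ring
  rw [he] at h2 ⊢
  rw [padicHaar₂] at hi ⊢
  rw [integral_prod_symm _ hi]
  simp only [(slice_outside a b c _).2 h1]
  rw [integral_const_mul, integral_padicPsi_cpow h2]

/-- For `|y| > 1` the region is the ball `|x| ≤ |y|` without the smaller ball `|x| < |y|`, which
accounts for the term `-p⁻¹`. For `|y| ≤ 1` it is the whole unit ball, and the indicator term
restores the `p⁻¹`. -/
theorem slice_diagonal (a b c : ℂ) (y : ℚ_[p]) :
    (Integrable (fun x => {z : ℚ_[p] × ℚ_[p] | padicPsi z.1 = padicPsi z.2}.indicator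
      (jIntegrand p a b c) (x, y)) (padicHaar p) ↔ 0 < (c + 1).re) ∧
    (0 < (c + 1).re →
      ∫ x, {z : ℚ_[p] × ℚ_[p] | padicPsi z.1 = padicPsi z.2}.indicator
        (jIntegrand p a b c) (x, y) ∂(padicHaar p) =
      ((1 - (p : ℂ)⁻¹) / (1 - (p : ℂ) ^ (-(c + 1))) - (p : ℂ)⁻¹) *
        (padicPsi y : ℂ) ^ (a + b + c + 1) +
      {y : ℚ_[p] | ‖y‖ ≤ 1}.indicator (fun _ => (p : ℂ)⁻¹) y) := by
  obtain ⟨m, hm⟩ := exists_padicPsi_eq_zpow y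
  have hψ : (padicPsi y : ℂ) ≠ 0 := by exact_mod_cast (padicPsi_pos y).ne'
  have hne : (padicPsi y : ℂ) ^ (a + b) ≠ 0 := by simp [Complex.cpow_eq_zero_iff, hψ]
  have key := integral_norm_cpow_closedBall (p := p) c m
  set h₀ : ℚ_[p] → ℂ := {x : ℚ_[p] | ‖x‖ ≤ (p : ℝ) ^ (m : ℤ)}.indicator
    fun x => (‖x‖ : ℂ) ^ c with hh₀
  -- Since `|y| ≤ p^m`, the ball of radius `p^m` is stable under translation by `y`, which moves the
  -- singularity to the origin.
  have keyI : Integrable (fun x => h₀ (x - y)) (padicHaar p) ↔ 0 < (c + 1).re := by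
    refine Iff.trans ⟨fun h => ?_, fun h => h.comp_sub_right y⟩ key.1
    simpa using h.comp_add_right y
  have keyV : ∫ x, h₀ (x - y) ∂(padicHaar p) = ∫ x, h₀ x ∂(padicHaar p) :=
    integral_sub_right_eq_self h₀ y
  rcases le_or_gt ‖y‖ 1 with hy | hy
  · have hm0 : (p : ℝ) ^ (m : ℤ) = 1 := by rw [← hm, padicPsi_of_norm_le_one hy]
    have hs : (fun x => {z : ℚ_[p] × ℚ_[p] | padicPsi z.1 = padicPsi z.2}.indicator
        (jIntegrand p a b c) (x, y)) = fun x => h₀ (x - y) := by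
      ext x
      by_cases h : ‖x‖ ≤ 1
      · have hxy : ‖x - y‖ ≤ 1 := (padic_norm_sub_le_max x y).trans (max_le h hy)
        simp only [hh₀, hm0, Set.indicator, Set.mem_ofPred_eq]
        rw [if_pos ((padicPsi_of_norm_le_one h).trans (padicPsi_of_norm_le_one hy).symm),
          if_pos hxy, jIntegrand,
          padicPsi_of_norm_le_one h, padicPsi_of_norm_le_one hy]
        simp
      · have hxy : ¬ ‖x - y‖ ≤ 1 := by
          rw [norm_sub_eq_left (hy.trans_lt (not_le.1 h))]; exact h
        have hne : padicPsi x ≠ padicPsi y := fun h' => h (by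
          rw [padicPsi_of_norm_le_one hy] at h'
          exact h' ▸ norm_le_padicPsi x)
        simp only [hh₀, hm0, Set.indicator, Set.mem_ofPred_eq]
        rw [if_neg hne, if_neg hxy]
    have hm0' : m = 0 := by
      have := zpow_right_injective₀ (prime_cast_pos (p := p)) one_lt_prime_cast.ne'
        (hm0.trans (zpow_zero (p : ℝ)).symm)
      exact_mod_cast this
    rw [hs]
    refine ⟨keyI, fun h => ?_⟩
    rw [keyV, key.2 h, padicPsi_of_norm_le_one hy, hm0']
    simp [Set.indicator, hy]
  · have hyp : padicPsi y = ‖y‖ := padicPsi_of_one_lt_norm hy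
    -- By discreteness the radius `p^(m-1)` describes `|x| < |y|`, and there `|x - y| = |y|` is
    -- constant.
    set g₀ : ℚ_[p] → ℂ := (Metric.closedBall (0 : ℚ_[p]) ((p : ℝ) ^ ((m : ℤ) - 1))).indicator
      fun _ => (padicPsi y : ℂ) ^ c with hg₀
    have hg : Integrable g₀ (padicHaar p) := by
      rw [hg₀, integrable_indicator_iff Metric.isClosed_closedBall.measurableSet]
      exact integrableOn_const (by simp [padicHaar_closedBall])
    have hgV : ∫ x, g₀ x ∂(padicHaar p) =
        (p : ℂ) ^ ((m : ℤ) - 1) * (padicPsi y : ℂ) ^ c := by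
      rw [hg₀, integral_indicator Metric.isClosed_closedBall.measurableSet, setIntegral_const,
        Measure.real, padicHaar_closedBall, ENNReal.toReal_ofReal (zpow_pos prime_cast_pos _).le,
        Complex.real_smul]
      push_cast
      rfl
    have hs : (fun x => {z : ℚ_[p] × ℚ_[p] | padicPsi z.1 = padicPsi z.2}.indicator
        (jIntegrand p a b c) (x, y)) =
        fun x => (padicPsi y : ℂ) ^ (a + b) * (h₀ (x - y) - g₀ x) := by
      ext x
      have hball : x ∈ Metric.closedBall (0 : ℚ_[p]) ((p : ℝ) ^ ((m : ℤ) - 1)) ↔ ‖x‖ < ‖y‖ := by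
        rw [mem_closedBall_zero_iff, Padic.norm_le_pow_iff_norm_lt_pow_add_one, sub_add_cancel,
          ← hm, hyp]
      rcases lt_trichotomy ‖x‖ ‖y‖ with h | h | h
      · have hxy : ‖x - y‖ = ‖y‖ := by rw [norm_sub_rev, norm_sub_eq_left h]
        simp only [hg₀, hh₀, Set.indicator, Set.mem_ofPred_eq]
        rw [if_pos (hball.2 h), if_pos (hxy.trans (hyp.symm.trans hm)).le,
          if_neg (show padicPsi x ≠ padicPsi y from ((max_lt h hy).trans_eq hyp.symm).ne), hxy, hyp,
          sub_self, mul_zero]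
      · have hxp : padicPsi x = padicPsi y := by rw [padicPsi, padicPsi, h]
        have hxy : ‖x - y‖ ≤ (p : ℝ) ^ (m : ℤ) := by
          rw [← hm, hyp]
          exact (padic_norm_sub_le_max x y).trans (max_le h.le le_rfl)
        simp only [hg₀, hh₀, Set.indicator, Set.mem_ofPred_eq]
        rw [if_neg (fun h' => (hball.1 h').ne h), if_pos hxy, if_pos hxp, jIntegrand, hxp,
          Complex.cpow_add _ _ hψ, sub_zero]
      · have hxy : ‖x - y‖ = ‖x‖ := norm_sub_eq_left h
        have hxy' : ¬ ‖x - y‖ ≤ (p : ℝ) ^ (m : ℤ) := by rw [← hm, hyp, hxy]; exact not_le.2 h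
        simp only [hg₀, hh₀, Set.indicator, Set.mem_ofPred_eq]
        rw [if_neg (fun h' => (hball.1 h').not_gt h), if_neg hxy', sub_zero, mul_zero,
          if_neg (hyp.trans_lt (h.trans_le (norm_le_padicPsi x))).ne']
    have hI : Integrable (fun x => h₀ (x - y) - g₀ x) (padicHaar p) ↔ 0 < (c + 1).re := by
      rw [← keyI]
      exact ⟨fun h => (h.add hg).congr (.of_forall fun x => by simp), fun h => h.sub hg⟩
    have hy' : y ∉ {y : ℚ_[p] | ‖y‖ ≤ 1} := by simpa using hy
    rw [hs]
    refine ⟨(integrable_const_mul_iff (IsUnit.mk0 _ hne) _).trans hI, fun h => ?_⟩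
    rw [integral_const_mul, integral_sub (keyI.2 h) hg, keyV, key.2 h, hgV,
      Set.indicator_of_notMem hy', hm, prime_zpow_cpow,
      prime_zpow_cpow, prime_zpow_cpow, show a + b + c + 1 = (a + b) + (c + 1) by ring,
      prime_cpow_add (a + b), mul_zpow, zpow_sub_one₀ prime_cast_complex_ne_zero,
      prime_cpow_add_one c, mul_zpow]
    ring

theorem integrable_indicator_integers (C : ℂ) :
    Integrable ({y : ℚ_[p] | ‖y‖ ≤ 1}.indicator fun _ => C) (padicHaar p) := by
  rw [integrable_indicator_iff (measurableSet_le measurable_norm measurable_const)]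
  exact integrableOn_const (by simp [padicHaar_integers])

/-- The first quotient exceeds `1 - p⁻¹ ≥ 1/2 ≥ p⁻¹`. Were the constant zero, the diagonal region
would not force `Re (a + b + c + 2) < 0`. -/
theorem diagonal_const_ne_zero {c : ℝ} (hc : 0 < c + 1) :
    (1 - (p : ℂ)⁻¹) / (1 - (p : ℂ) ^ (-((c : ℂ) + 1))) - (p : ℂ)⁻¹ ≠ 0 := by
  have hp2 : (2 : ℝ) ≤ p := by exact_mod_cast hp.out.two_le
  have h1 : (p : ℝ) ^ (-(c + 1)) < 1 := Real.rpow_lt_one_of_one_lt_of_neg one_lt_prime_cast (by linarith)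
  have h2 : 0 < (p : ℝ) ^ (-(c + 1)) := Real.rpow_pos_of_pos prime_cast_pos _
  have h3 : (p : ℝ)⁻¹ ≤ 2⁻¹ := inv_anti₀ (by norm_num) hp2
  have h4 : 0 < (1 - (p : ℝ)⁻¹) / (1 - (p : ℝ) ^ (-(c + 1))) - (p : ℝ)⁻¹ := by
    rw [sub_pos, lt_div_iff₀ (by linarith)]
    have : 0 < (p : ℝ)⁻¹ := inv_pos.2 prime_cast_pos
    nlinarith
  have h5 := Complex.ofReal_ne_zero.2 h4.ne'
  rw [Complex.ofReal_sub, Complex.ofReal_div, Complex.ofReal_sub, Complex.ofReal_sub,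
    Complex.ofReal_cpow prime_cast_pos.le] at h5
  push_cast at h5
  exact h5

theorem integrable_diagonal_iff (a b c : ℂ) :
    Integrable ({z : ℚ_[p] × ℚ_[p] | padicPsi z.1 = padicPsi z.2}.indicator (jIntegrand p a b c))
      (padicHaar₂ p) ↔ 0 < (c + 1).re ∧ (a + b + c + 2).re < 0 := by
  rw [padicHaar₂, integrable_prod_iff_of_ofReal_norm
    ((measurable_jIntegrand a b c).indicator measurableSet_padicPsi_eq).aestronglyMeasurable
    (ofReal_norm_indicator_jIntegrand _ a b c)]
  simp only [(slice_diagonal a b c _).1, Filter.eventually_const]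
  refine and_congr_right fun h => ?_
  have h' : 0 < ((c.re : ℂ) + 1).re := by simpa using h
  simp only [(slice_diagonal (a.re : ℂ) b.re c.re _).2 h']
  refine (integrable_add_iff_integrable_left (integrable_indicator_integers _)).trans ?_
  rw [integrable_const_mul_iff (IsUnit.mk0 _ (diagonal_const_ne_zero (by simpa using h))),
    integrable_padicPsi_cpow_iff]
  simp only [Complex.add_re, Complex.ofReal_re, Complex.one_re, Complex.re_ofNat]
  constructor <;> intro h <;> linarith

theorem integral_diagonal {a b c : ℂ} (h1 : 0 < (c + 1).re) (h2 : (a + b + c + 2).re < 0) :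
    ∫ z, {z : ℚ_[p] × ℚ_[p] | padicPsi z.1 = padicPsi z.2}.indicator (jIntegrand p a b c) z
      ∂(padicHaar₂ p) =
    ((1 - (p : ℂ)⁻¹) / (1 - (p : ℂ) ^ (-(c + 1))) - (p : ℂ)⁻¹) *
      ((1 - (p : ℂ)⁻¹ * (p : ℂ) ^ (a + b + c + 2)) / (1 - (p : ℂ) ^ (a + b + c + 2))) +
      (p : ℂ)⁻¹ := by
  have hi := (integrable_diagonal_iff (p := p) a b c).2 ⟨h1, h2⟩
  have he : a + b + c + 2 = a + b + c + 1 + 1 := by ring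
  rw [he] at h2 ⊢
  rw [padicHaar₂] at hi ⊢
  rw [integral_prod_symm _ hi]
  simp only [(slice_diagonal a b c _).2 h1]
  rw [integral_add (((integrable_padicPsi_cpow_iff _).2 h2).const_mul _)
    (integrable_indicator_integers _), integral_const_mul, integral_padicPsi_cpow h2,
    integral_indicator (measurableSet_le measurable_norm measurable_const), setIntegral_const,
    Measure.real, padicHaar_integers]
  simp

theorem jIntegrand_swap (a b c : ℂ) (z : ℚ_[p] × ℚ_[p]) :
    jIntegrand p a b c z.swap = jIntegrand p b a c z := by
  simp only [jIntegrand, Prod.fst_swap, Prod.snd_swap]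
  rw [norm_sub_rev, mul_comm ((padicPsi z.2 : ℂ) ^ a)]

theorem indicator_gt_swap (a b c : ℂ) (z : ℚ_[p] × ℚ_[p]) :
    {z : ℚ_[p] × ℚ_[p] | padicPsi z.1 < padicPsi z.2}.indicator (jIntegrand p a b c) z.swap =
      {z : ℚ_[p] × ℚ_[p] | padicPsi z.2 < padicPsi z.1}.indicator (jIntegrand p b a c) z := by
  simp only [Set.indicator, jIntegrand_swap]
  rfl

theorem measurePreserving_swap_padicHaar₂ :
    MeasurePreserving (MeasurableEquiv.prodComm : ℚ_[p] × ℚ_[p] ≃ᵐ ℚ_[p] × ℚ_[p])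
      (padicHaar₂ p) (padicHaar₂ p) :=
  Measure.measurePreserving_swap

theorem integrable_inside_iff (a b c : ℂ) :
    Integrable ({z : ℚ_[p] × ℚ_[p] | padicPsi z.1 < padicPsi z.2}.indicator (jIntegrand p a b c))
      (padicHaar₂ p) ↔ (b + c + 1).re < 0 ∧ (a + b + c + 2).re < 0 := by
  rw [add_comm a b, ← integrable_outside_iff (p := p) b a c,
    ← measurePreserving_swap_padicHaar₂.integrable_comp_emb MeasurableEquiv.prodComm.measurableEmbedding]
  exact integrable_congr (.of_forall (indicator_gt_swap a b c))

theorem integral_inside {a b c : ℂ} (h1 : (b + c + 1).re < 0) (h2 : (a + b + c + 2).re < 0) :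
    ∫ z, {z : ℚ_[p] × ℚ_[p] | padicPsi z.1 < padicPsi z.2}.indicator (jIntegrand p a b c) z
      ∂(padicHaar₂ p) =
    (1 - (p : ℂ)⁻¹) * (p : ℂ) ^ (b + c + 1) / (1 - (p : ℂ) ^ (b + c + 1)) *
      ((1 - (p : ℂ)⁻¹ * (p : ℂ) ^ (a + b + c + 2)) / (1 - (p : ℂ) ^ (a + b + c + 2))) := by
  rw [add_comm a b] at h2 ⊢
  rw [← integral_outside h1 h2, ← measurePreserving_swap_padicHaar₂.integral_comp']
  exact integral_congr_ae (.of_forall (indicator_gt_swap a b c))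

theorem jIntegrand_eq_sum (a b c : ℂ) (z : ℚ_[p] × ℚ_[p]) :
    jIntegrand p a b c z =
      {z : ℚ_[p] × ℚ_[p] | padicPsi z.2 < padicPsi z.1}.indicator (jIntegrand p a b c) z +
      {z : ℚ_[p] × ℚ_[p] | padicPsi z.1 < padicPsi z.2}.indicator (jIntegrand p a b c) z +
      {z : ℚ_[p] × ℚ_[p] | padicPsi z.1 = padicPsi z.2}.indicator (jIntegrand p a b c) z := by
  simp only [Set.indicator, Set.mem_ofPred_eq]
  rcases lt_trichotomy (padicPsi z.1) (padicPsi z.2) with h | h | h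
  · simp [h, h.not_gt, h.ne]
  · simp [h]
  · simp [h, h.not_gt, h.ne']

theorem integrable_jIntegrand_iff (a b c : ℂ) :
    Integrable (jIntegrand p a b c) (padicHaar₂ p) ↔
      0 < (c + 1).re ∧ 0 < (-a - c - 1).re ∧ 0 < (-b - c - 1).re ∧ 0 < (-a - b - c - 2).re := by
  have h : Integrable (jIntegrand p a b c) (padicHaar₂ p) ↔
      ((a + c + 1).re < 0 ∧ (a + b + c + 2).re < 0) ∧
      ((b + c + 1).re < 0 ∧ (a + b + c + 2).re < 0) ∧
      (0 < (c + 1).re ∧ (a + b + c + 2).re < 0) := by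
    rw [← integrable_outside_iff (p := p), ← integrable_inside_iff (p := p),
      ← integrable_diagonal_iff (p := p)]
    refine ⟨fun h => ⟨h.indicator measurableSet_padicPsi_lt, h.indicator measurableSet_padicPsi_gt,
      h.indicator measurableSet_padicPsi_eq⟩, fun h => ?_⟩
    exact ((h.1.add h.2.1).add h.2.2).congr
      (.of_forall fun z => (jIntegrand_eq_sum a b c z).symm)
  rw [h]
  simp only [Complex.add_re, Complex.sub_re, Complex.neg_re, Complex.one_re, Complex.re_ofNat]
  constructor
  · rintro ⟨⟨h1, h2⟩, ⟨h3, -⟩, h4, -⟩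
    refine ⟨?_, ?_, ?_, ?_⟩ <;> linarith
  · rintro ⟨h1, h2, h3, h4⟩
    refine ⟨⟨?_, ?_⟩, ⟨?_, ?_⟩, ?_, ?_⟩ <;> linarith

/-- The convention `0⁻¹ = 0` makes this valid for all `a b c d x y z`, so the Gamma factors in the
denominator need no separate nonvanishing check. -/
theorem div_mul_cancel_of_gamma {k : ℂ} (hk : k ≠ 0) (a b c d x y z : ℂ) :
    k / c * (k / a) * (k / b) * (k / d) / (k / x * (k / y) * (k / z)) =
      k * (x * y * z) / (c * a * b * d) := by
  simp only [div_eq_mul_inv, mul_inv, inv_inv]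
  field_simp

/-- The sum of the three regional integrals, with `q = p`, `A = p^(a+c+1)`, `B = p^(b+c+1)`, `C =
p^(-(c+1))`, `D = p^(a+b+c+2)`. Then `AC = p^a`, `BC = p^b` and `AB = p^(a+b+2c+2)` give the Gamma
factors of the denominator. -/
theorem gamma_identity {A B C D q : ℂ} (hq : q ≠ 0) (hq1 : 1 - q⁻¹ ≠ 0) (hA : 1 - A ≠ 0)
    (hB : 1 - B ≠ 0) (hC : 1 - C ≠ 0) (hD : 1 - D ≠ 0) (h : D = A * B * C * q) :
    (1 - q⁻¹) * A / (1 - A) * ((1 - q⁻¹ * D) / (1 - D)) +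
      (1 - q⁻¹) * B / (1 - B) * ((1 - q⁻¹ * D) / (1 - D)) +
      (((1 - q⁻¹) / (1 - C) - q⁻¹) * ((1 - q⁻¹ * D) / (1 - D)) + q⁻¹) =
    (1 - q⁻¹) / (1 - C) * ((1 - q⁻¹) / (1 - A)) * ((1 - q⁻¹) / (1 - B)) * ((1 - q⁻¹) / (1 - D)) /
      ((1 - q⁻¹) / (1 - A * C) * ((1 - q⁻¹) / (1 - B * C)) * ((1 - q⁻¹) / (1 - A * B))) := by
  rw [div_mul_cancel_of_gamma hq1]
  field_simp
  rw [h]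
  ring

theorem jIntegral_eq {a b c : ℂ} (h1 : 0 < (c + 1).re) (h2 : 0 < (-a - c - 1).re)
    (h3 : 0 < (-b - c - 1).re) (h4 : 0 < (-a - b - c - 2).re) :
    jIntegral p a b c =
      padicGamma p (c + 1) * padicGamma p (-a - c - 1) * padicGamma p (-b - c - 1) *
          padicGamma p (-a - b - c - 2) /
        (padicGamma p (-a) * padicGamma p (-b) * padicGamma p (-a - b - 2 * c - 2)) := by
  have h2' : (a + c + 1).re < 0 := by simp at h2 ⊢; linarith
  have h3' : (b + c + 1).re < 0 := by simp at h3 ⊢; linarith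
  have h4' : (a + b + c + 2).re < 0 := by simp at h4 ⊢; linarith
  have h1' : (-(c + 1)).re < 0 := by simp at h1 ⊢; linarith
  have hi1 := (integrable_outside_iff (p := p) a b c).2 ⟨h2', h4'⟩
  have hi2 := (integrable_inside_iff (p := p) a b c).2 ⟨h3', h4'⟩
  have hi3 := (integrable_diagonal_iff (p := p) a b c).2 ⟨h1, h4'⟩
  have hD : (p : ℂ) ^ (a + b + c + 2) =
      (p : ℂ) ^ (a + c + 1) * (p : ℂ) ^ (b + c + 1) * (p : ℂ) ^ (-(c + 1)) * p := by
    rw [← prime_cpow_add, ← prime_cpow_add, ← prime_cpow_add_one]; congr 1; ring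
  rw [jIntegral, integral_congr_ae (.of_forall (jIntegrand_eq_sum a b c)),
    integral_add (by exact hi1.add hi2) hi3, integral_add hi1 hi2, integral_outside h2' h4',
    integral_inside h3' h4', integral_diagonal h1 h4',
    gamma_identity prime_cast_complex_ne_zero one_sub_inv_prime_ne_zero
      (one_sub_prime_cpow_ne_zero h2') (one_sub_prime_cpow_ne_zero h3')
      (one_sub_prime_cpow_ne_zero h1') (one_sub_prime_cpow_ne_zero h4') hD]
  simp only [padicGamma, ← prime_cpow_add]
  ring_nf

end DoubleIntegral

/-! ### The invariant measure on the projective line -/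

section Projective

open scoped NNReal ENNReal

variable {p : ℕ} [hp : Fact p.Prime]

theorem padicPsi_cpow_neg_two (x : ℚ_[p]) :
    (padicPsi x : ℂ) ^ (-2 : ℂ) = (((padicPsi x ^ 2)⁻¹ : ℝ) : ℂ) := by
  rw [Complex.cpow_neg]
  norm_cast

theorem integrable_padicPsi_sq_inv :
    Integrable (fun x : ℚ_[p] => (padicPsi x ^ 2)⁻¹) (padicHaar p) := by
  rw [← integrable_complex_ofReal_iff]
  simp only [← padicPsi_cpow_neg_two]
  rw [integrable_padicPsi_cpow_iff]
  norm_num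

theorem integral_padicPsi_sq_inv :
    ∫ x : ℚ_[p], (padicPsi x ^ 2)⁻¹ ∂(padicHaar p) = 1 + (p : ℝ)⁻¹ := by
  have h : ((-2 : ℂ) + 1).re < 0 := by norm_num
  have h1 := integral_padicPsi_cpow (p := p) h
  simp only [padicPsi_cpow_neg_two] at h1
  rw [integral_complex_ofReal, show (-2 : ℂ) + 1 = -1 by norm_num, Complex.cpow_neg,
    Complex.cpow_one] at h1
  have h2 : (1 - (p : ℂ)⁻¹ * (p : ℂ)⁻¹) / (1 - (p : ℂ)⁻¹) = ((1 + (p : ℝ)⁻¹ : ℝ) : ℂ) := by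
    rw [div_eq_iff one_sub_inv_prime_ne_zero]
    push_cast
    ring
  rw [h2] at h1
  exact_mod_cast h1

/-- The density `ψ_p(x)⁻²` of the rotation-invariant measure on the projective line. -/
def projDensity (x : ℚ_[p]) : ℝ≥0 := (max ‖x‖₊ 1 ^ 2)⁻¹

theorem coe_projDensity (x : ℚ_[p]) : (projDensity x : ℝ) = (padicPsi x ^ 2)⁻¹ := by
  simp [projDensity, padicPsi]

theorem measurable_projDensity : Measurable (projDensity : ℚ_[p] → ℝ≥0) := by
  unfold projDensity
  fun_prop

variable (p) in
/-- The measure `ψ_p(x)⁻² d_p x`, invariant under the action of `GL₂(ℤ_p)` on the projective line. -/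
def projMeasure : Measure ℚ_[p] := (padicHaar p).withDensity fun x => (projDensity x : ℝ≥0∞)

instance : IsFiniteMeasure (projMeasure p) := by
  refine isFiniteMeasure_withDensity ?_
  have h := (integrable_padicPsi_sq_inv (p := p)).lintegral_lt_top
  simp only [← coe_projDensity, ENNReal.ofReal_coe_nnreal] at h
  exact h.ne

theorem padicPsi_eq_of_norm_eq {x y : ℚ_[p]} (h : ‖x‖ = ‖y‖) : padicPsi x = padicPsi y := by
  rw [padicPsi, padicPsi, h]

theorem norm_eq_of_mem_closedBall {a x : ℚ_[p]} {r : ℝ} (hr : r < ‖a‖)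
    (hx : x ∈ Metric.closedBall a r) : ‖x‖ = ‖a‖ := by
  rw [Metric.mem_closedBall, dist_eq_norm, norm_sub_rev] at hx
  rw [← norm_sub_eq_left (hx.trans_lt hr), sub_sub_cancel]

theorem projMeasure_closedBall {a : ℚ_[p]} {n : ℤ} (h : (p : ℝ) ^ n < ‖a‖) :
    projMeasure p (Metric.closedBall a ((p : ℝ) ^ n)) =
      ENNReal.ofReal ((padicPsi a ^ 2)⁻¹ * (p : ℝ) ^ n) := by
  have hB : MeasurableSet (Metric.closedBall a ((p : ℝ) ^ n)) :=
    Metric.isClosed_closedBall.measurableSet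
  have hc : ∀ x ∈ Metric.closedBall a ((p : ℝ) ^ n),
      (projDensity x : ℝ≥0∞) = (projDensity a : ℝ≥0∞) := fun x hx => by
    rw [ENNReal.coe_inj, ← NNReal.coe_inj, coe_projDensity, coe_projDensity,
      padicPsi_eq_of_norm_eq (norm_eq_of_mem_closedBall h hx)]
  rw [projMeasure, withDensity_apply _ hB, setLIntegral_congr_fun hB hc, setLIntegral_const,
    padicHaar_closedBall, ENNReal.ofReal_mul (by positivity), ← coe_projDensity,
    ENNReal.ofReal_coe_nnreal]

theorem padicPsi_inv {x : ℚ_[p]} (hx : x ≠ 0) : padicPsi x⁻¹ = padicPsi x / ‖x‖ := by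
  have h : 0 < ‖x‖ := norm_pos_iff.2 hx
  rw [padicPsi, padicPsi, norm_inv, max_comm ‖x‖ 1, ← max_div_div_right h.le, div_self h.ne', one_div]

theorem norm_inv_sub_inv {x y : ℚ_[p]} (hx : x ≠ 0) (hy : y ≠ 0) :
    ‖x⁻¹ - y⁻¹‖ = ‖x - y‖ / (‖x‖ * ‖y‖) := by
  rw [inv_sub_inv hx hy, norm_div, norm_mul, norm_sub_rev]

/-- On a ball avoiding the origin the norm is constant, so `|x⁻¹ - y⁻¹| = |x - y| / (|x| |y|)` makes
inversion a similarity of ratio `|a|⁻²`. -/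
theorem preimage_inv_closedBall {a : ℚ_[p]} {r : ℝ} (hr : r < ‖a‖) (hr0 : 0 < r) :
    (fun x : ℚ_[p] => x⁻¹) ⁻¹' Metric.closedBall a r = Metric.closedBall a⁻¹ (r / ‖a‖ ^ 2) := by
  have ha : 0 < ‖a‖ := hr0.trans hr
  have ha0 : a ≠ 0 := norm_pos_iff.1 ha
  have hr' : r / ‖a‖ ^ 2 < ‖a⁻¹‖ := by
    rw [norm_inv, div_lt_iff₀ (by positivity)]
    field_simp
    exact hr
  ext x
  rw [Set.mem_preimage]
  have key (hx : ‖x‖ = ‖a⁻¹‖) :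
      x⁻¹ ∈ Metric.closedBall a r ↔ x ∈ Metric.closedBall a⁻¹ (r / ‖a‖ ^ 2) := by
    have hx0 : x ≠ 0 := norm_pos_iff.1 (hx ▸ norm_pos_iff.2 (inv_ne_zero ha0))
    have : ‖x - a⁻¹‖ = ‖x⁻¹ - a‖ / ‖a‖ ^ 2 := by
      have h := norm_inv_sub_inv (inv_ne_zero hx0) ha0
      rw [inv_inv, norm_inv x, hx, norm_inv, inv_inv] at h
      rw [h, sq]
    rw [Metric.mem_closedBall, Metric.mem_closedBall, dist_eq_norm, dist_eq_norm, this,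
      div_le_div_iff_of_pos_right (by positivity)]
  constructor
  · intro h
    have h1 := norm_eq_of_mem_closedBall hr h
    exact (key (by rw [norm_inv, ← h1, norm_inv, inv_inv])).1 h
  · intro h
    exact (key (norm_eq_of_mem_closedBall hr' h)).2 h

variable (p) in
/-- The balls of radius a power of `p` that do not contain the origin, with the empty set. -/
def puncturedBalls : Set (Set ℚ_[p]) :=
  {s | s = ∅ ∨ ∃ (a : ℚ_[p]) (n : ℤ), (p : ℝ) ^ n < ‖a‖ ∧ s = Metric.closedBall a ((p : ℝ) ^ n)}

/-- Ultrametric balls are nested or disjoint. -/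
theorem isPiSystem_puncturedBalls : IsPiSystem (puncturedBalls p) := by
  rintro s hs t ht hne
  rcases hs with rfl | ⟨a, m, ha, rfl⟩
  · simp at hne
  rcases ht with rfl | ⟨b, n, hb, rfl⟩
  · simp at hne
  rcases IsUltrametricDist.closedBall_subset_trichotomy a b ((p : ℝ) ^ m) ((p : ℝ) ^ n)
    with h | h | h
  · rw [Set.inter_eq_left.2 h]; exact Or.inr ⟨a, m, ha, rfl⟩
  · rw [Set.inter_eq_right.2 h]; exact Or.inr ⟨b, n, hb, rfl⟩
  · exact absurd hne (Set.not_nonempty_iff_eq_empty.2 h.inter_eq)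

theorem exists_zpow_lt {ε : ℝ} (hε : 0 < ε) : ∃ n : ℤ, (p : ℝ) ^ n < ε := by
  obtain ⟨n, hn⟩ := exists_pow_lt_of_lt_one hε (inv_lt_one_of_one_lt₀ (one_lt_prime_cast (p := p)))
  exact ⟨-n, by simpa using hn⟩

theorem exists_countable_iUnion_puncturedBalls {U : Set ℚ_[p]} (hU : IsOpen U) (h0 : 0 ∉ U) :
    ∃ T : Set (Set ℚ_[p]), T ⊆ puncturedBalls p ∧ T.Countable ∧ ⋃₀ T = U := by
  have (x : ℚ_[p]) : ∃ n : ℤ, x ∈ U → (p : ℝ) ^ n < ‖x‖ ∧ Metric.closedBall x ((p : ℝ) ^ n) ⊆ U := by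
    by_cases hx : x ∈ U
    · obtain ⟨ε, hε, hb⟩ := Metric.isOpen_iff.1 hU x hx
      have hx0 : 0 < ‖x‖ := norm_pos_iff.2 fun h => h0 (h ▸ hx)
      obtain ⟨n, hn⟩ := exists_zpow_lt (p := p) (lt_min hε hx0)
      exact ⟨n, fun _ => ⟨hn.trans_le (min_le_right _ _),
        (Metric.closedBall_subset_ball (hn.trans_le (min_le_left _ _))).trans hb⟩⟩
    -- An arbitrary exponent off `U`, so that `choose` yields a total function.
    · exact ⟨0, fun h => absurd h hx⟩
  choose n hn using this
  obtain ⟨t, htU, htc, hcov⟩ := TopologicalSpace.countable_cover_nhdsWithin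
    (f := fun x => Metric.closedBall x ((p : ℝ) ^ n x)) (s := U)
    fun x _ => mem_nhdsWithin_of_mem_nhds (Metric.closedBall_mem_nhds _ (zpow_pos prime_cast_pos _))
  refine ⟨(fun x => Metric.closedBall x ((p : ℝ) ^ n x)) '' t, ?_, htc.image _, ?_⟩
  · rintro _ ⟨x, hx, rfl⟩
    exact Or.inr ⟨x, n x, (hn x (htU hx)).1, rfl⟩
  · rw [Set.sUnion_image]
    exact Set.Subset.antisymm (Set.iUnion₂_subset fun x hx => (hn x (htU hx)).2) hcov

theorem borel_eq_generateFrom_puncturedBalls :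
    padicMeasurableSpace p = MeasurableSpace.generateFrom (puncturedBalls p) := by
  refine le_antisymm ?_ (MeasurableSpace.generateFrom_le ?_)
  · have hopen {U : Set ℚ_[p]} (hU : IsOpen U) (h0 : 0 ∉ U) :
        MeasurableSet[MeasurableSpace.generateFrom (puncturedBalls p)] U := by
      obtain ⟨T, hT, hc, rfl⟩ := exists_countable_iUnion_puncturedBalls hU h0
      exact @MeasurableSet.sUnion _ (MeasurableSpace.generateFrom (puncturedBalls p)) _ hc
        fun s hs => MeasurableSpace.measurableSet_generateFrom (hT hs)
    refine MeasurableSpace.generateFrom_le fun U hU => ?_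
    have hU' : IsOpen U := hU
    -- No punctured ball contains the origin, so `{0}` is obtained as a complement.
    have hz : MeasurableSet[MeasurableSpace.generateFrom (puncturedBalls p)] ({0} : Set ℚ_[p]) := by
      have := (hopen (U := {0}ᶜ) isOpen_compl_singleton (by simp)).compl
      rwa [compl_compl] at this
    by_cases h0 : (0 : ℚ_[p]) ∈ U
    · have h1 := hopen (U := U \ {0}) (hU'.sdiff isClosed_singleton) (by simp)
      have h2 := h1.union hz
      rwa [Set.sdiff_union_of_subset (by simpa using h0)] at h2
    · exact hopen hU' h0
  · rintro s (rfl | ⟨a, n, -, rfl⟩)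
    · exact MeasurableSet.empty
    · exact Metric.isClosed_closedBall.measurableSet

/-- Finite measures that agree on a generating π-system and in total mass are equal. On a punctured
ball the scaling of Haar measure by `|a|⁻²` cancels against `ψ(a⁻¹)⁻² = |a|² ψ(a)⁻²`. -/
theorem measurePreserving_inv_projMeasure :
    MeasurePreserving (MeasurableEquiv.inv ℚ_[p]) (projMeasure p) (projMeasure p) := by
  have hm : Measurable (MeasurableEquiv.inv ℚ_[p]) := MeasurableEquiv.measurable _
  refine ⟨hm, Eq.symm ?_⟩
  refine ext_of_generate_finite (puncturedBalls p) borel_eq_generateFrom_puncturedBalls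
    isPiSystem_puncturedBalls ?_ ?_
  · rintro s (rfl | ⟨a, n, ha, rfl⟩)
    · simp
    · have hr0 : (0 : ℝ) < (p : ℝ) ^ n := zpow_pos prime_cast_pos n
      have ha0 : a ≠ 0 := norm_pos_iff.1 (hr0.trans ha)
      have hna : 0 < ‖a‖ := norm_pos_iff.2 ha0
      obtain ⟨j, hj⟩ := exists_norm_eq_zpow ha0
      -- The image radius must again be a power of `p` for `projMeasure_closedBall` to apply.
      have hr : (p : ℝ) ^ n / ‖a‖ ^ 2 = (p : ℝ) ^ (n - 2 * j) := by
        rw [hj, zpow_sub₀ prime_cast_pos.ne', ← zpow_natCast, ← zpow_mul]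
        congr 2; push_cast; ring
      have hlt : (p : ℝ) ^ (n - 2 * j) < ‖a⁻¹‖ := by
        rw [← hr, norm_inv, div_lt_iff₀ (by positivity)]
        field_simp
        exact ha
      rw [Measure.map_apply hm Metric.isClosed_closedBall.measurableSet]
      change _ = projMeasure p ((fun x : ℚ_[p] => x⁻¹) ⁻¹' _)
      rw [preimage_inv_closedBall ha hr0, hr, projMeasure_closedBall ha, projMeasure_closedBall hlt,
        padicPsi_inv ha0, ← hr]
      congr 1
      field_simp
  · rw [Measure.map_apply hm MeasurableSet.univ]
    simp

theorem padicPsi_add {u : ℚ_[p]} (hu : ‖u‖ ≤ 1) (x : ℚ_[p]) : padicPsi (u + x) = padicPsi x := by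
  rcases le_or_gt ‖x‖ 1 with h | h
  · rw [padicPsi_of_norm_le_one h, padicPsi_of_norm_le_one]
    exact (Padic.nonarchimedean u x).trans (max_le hu h)
  · refine padicPsi_eq_of_norm_eq ?_
    rw [IsUltrametricDist.norm_add_eq_max_of_norm_ne_norm (hu.trans_lt h).ne,
      max_eq_right (hu.trans h.le)]

theorem measurePreserving_add_projMeasure {u : ℚ_[p]} (hu : ‖u‖ ≤ 1) :
    MeasurePreserving (MeasurableEquiv.addLeft u) (projMeasure p) (projMeasure p) := by
  have hm : Measurable (MeasurableEquiv.addLeft u) := MeasurableEquiv.measurable _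
  refine ⟨hm, Measure.ext fun s hs => ?_⟩
  rw [Measure.map_apply hm hs, projMeasure, withDensity_apply _ hs, withDensity_apply _ (hm hs)]
  have hMP := measurePreserving_add_left (padicHaar p) u
  have := hMP.setLIntegral_comp_preimage hs
    (f := fun x => (projDensity x : ℝ≥0∞)) measurable_projDensity.coe_nnreal_ennreal
  rw [← this]
  change ∫⁻ x in (fun x => u + x) ⁻¹' s, _ ∂_ = _
  refine lintegral_congr fun x => ?_
  rw [ENNReal.coe_inj, ← NNReal.coe_inj, coe_projDensity, coe_projDensity, padicPsi_add hu]

end Projective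

/-! ### Chordal distance and the triple integral -/

section TripleIntegral

open scoped NNReal ENNReal

variable {p : ℕ} [hp : Fact p.Prime]

/-- The chordal distance on the projective line over `ℚ_p`, in the affine coordinate. -/
def chordal (x y : ℚ_[p]) : ℝ := ‖x - y‖ / (padicPsi x * padicPsi y)

theorem chordal_add {u : ℚ_[p]} (hu : ‖u‖ ≤ 1) (x y : ℚ_[p]) :
    chordal (u + x) (u + y) = chordal x y := by
  rw [chordal, chordal, padicPsi_add hu, padicPsi_add hu, add_sub_add_left_eq_sub]

theorem chordal_inv {x y : ℚ_[p]} (hx : x ≠ 0) (hy : y ≠ 0) : chordal x⁻¹ y⁻¹ = chordal x y := by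
  have hx' : 0 < ‖x‖ := norm_pos_iff.2 hx
  have hy' : 0 < ‖y‖ := norm_pos_iff.2 hy
  rw [chordal, chordal, padicPsi_inv hx, padicPsi_inv hy, norm_inv_sub_inv hx hy]
  have := padicPsi_pos x
  have := padicPsi_pos y
  field_simp

theorem chordal_add_inv {z u : ℚ_[p]} (hz : ‖z‖ ≤ 1) (hu : u ≠ 0) :
    chordal z (z + u⁻¹) = (padicPsi u)⁻¹ := by
  have h := chordal_add hz 0 u⁻¹
  rw [add_zero] at h
  have hu' : 0 < ‖u‖ := norm_pos_iff.2 hu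
  have := padicPsi_pos u
  rw [h, chordal, padicPsi_inv hu, padicPsi_of_norm_le_one (by simp), zero_sub, norm_neg, norm_inv]
  field_simp

/-- An isometry of the projective line, defined off a finite set, that moves infinity to `z`. -/
theorem exists_measurePreserving_chordal (z : ℚ_[p]) :
    ∃ (e : ℚ_[p] ≃ᵐ ℚ_[p]) (S : Set ℚ_[p]), S.Finite ∧
      MeasurePreserving e (projMeasure p) (projMeasure p) ∧
      (∀ u ∉ S, chordal z (e u) = (padicPsi u)⁻¹) ∧
      ∀ u ∉ S, ∀ v ∉ S, chordal (e u) (e v) = chordal u v := by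
  rcases le_or_gt ‖z‖ 1 with hz | hz
  -- For `z ∈ ℤ_p` the map is `u ↦ z + u⁻¹`, which fails only at `u = 0`.
  · refine ⟨(MeasurableEquiv.inv ℚ_[p]).trans (MeasurableEquiv.addLeft z), {0}, Set.finite_singleton 0,
      (measurePreserving_add_projMeasure hz).comp measurePreserving_inv_projMeasure,
      fun u hu => chordal_add_inv hz hu, fun u hu v hv => ?_⟩
    change chordal (z + u⁻¹) (z + v⁻¹) = _
    rw [chordal_add hz, chordal_inv hu hv]
  · have hz0 : z ≠ 0 := norm_pos_iff.1 (one_pos.trans hz)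
    have hz' : ‖z⁻¹‖ ≤ 1 := by rw [norm_inv]; exact inv_le_one_of_one_le₀ hz.le
    have hS {u : ℚ_[p]} (hu : u ∉ ({0, -z} : Set ℚ_[p])) : u ≠ 0 ∧ z⁻¹ + u⁻¹ ≠ 0 := by
      simp only [Set.mem_insert_iff, Set.mem_singleton_iff, not_or] at hu
      refine ⟨hu.1, fun h => hu.2 ?_⟩
      rw [← inv_inj, inv_neg]
      exact eq_neg_of_add_eq_zero_right h
    -- For `|z| > 1` the previous map for `z⁻¹ ∈ ℤ_p`, followed by inversion: `u ↦ (z⁻¹ + u⁻¹)⁻¹`.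
    -- The point `-z` is excluded because it goes to infinity.
    refine ⟨((MeasurableEquiv.inv ℚ_[p]).trans (MeasurableEquiv.addLeft z⁻¹)).trans
      (MeasurableEquiv.inv ℚ_[p]), {0, -z}, Set.toFinite _,
      measurePreserving_inv_projMeasure.comp
        ((measurePreserving_add_projMeasure hz').comp measurePreserving_inv_projMeasure),
      fun u hu => ?_, fun u hu v hv => ?_⟩
    · change chordal z (z⁻¹ + u⁻¹)⁻¹ = _
      obtain ⟨h1, h2⟩ := hS hu
      have h := chordal_inv (inv_ne_zero hz0) h2
      rw [inv_inv] at h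
      rw [h, chordal_add_inv hz' h1]
    · change chordal (z⁻¹ + u⁻¹)⁻¹ (z⁻¹ + v⁻¹)⁻¹ = _
      obtain ⟨h1, h2⟩ := hS hu
      obtain ⟨h3, h4⟩ := hS hv
      rw [chordal_inv h2 h4, chordal_add hz', chordal_inv h1 h3]

theorem projMeasure_prod :
    (projMeasure p).prod (projMeasure p) =
      (padicHaar₂ p).withDensity
        fun w => ((projDensity w.1 * projDensity w.2 : ℝ≥0) : ℝ≥0∞) := by
  rw [projMeasure, prod_withDensity measurable_projDensity.coe_nnreal_ennreal
    measurable_projDensity.coe_nnreal_ennreal]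
  simp only [ENNReal.coe_mul, padicHaar₂]

theorem measurable_projDensity_mul :
    Measurable fun w : ℚ_[p] × ℚ_[p] => projDensity w.1 * projDensity w.2 :=
  (measurable_projDensity.comp measurable_fst).mul (measurable_projDensity.comp measurable_snd)

variable {E : Type*} [NormedAddCommGroup E] [NormedSpace ℝ E]

theorem integrable_projDensity_smul_comp_iff {e : ℚ_[p] ≃ᵐ ℚ_[p]}
    (he : MeasurePreserving e (projMeasure p) (projMeasure p)) (G : ℚ_[p] × ℚ_[p] → E) :
    Integrable (fun w => (projDensity w.1 * projDensity w.2) • G (e w.1, e w.2)) (padicHaar₂ p) ↔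
      Integrable (fun w => (projDensity w.1 * projDensity w.2) • G w) (padicHaar₂ p) := by
  rw [← integrable_withDensity_iff_integrable_smul measurable_projDensity_mul,
    ← integrable_withDensity_iff_integrable_smul measurable_projDensity_mul, ← projMeasure_prod]
  exact (he.prod he).integrable_comp_emb (e.prodCongr e).measurableEmbedding

theorem integral_projDensity_smul_comp {e : ℚ_[p] ≃ᵐ ℚ_[p]}
    (he : MeasurePreserving e (projMeasure p) (projMeasure p)) (G : ℚ_[p] × ℚ_[p] → E) :
    ∫ w, (projDensity w.1 * projDensity w.2) • G (e w.1, e w.2) ∂(padicHaar₂ p) =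
      ∫ w, (projDensity w.1 * projDensity w.2) • G w ∂(padicHaar₂ p) := by
  rw [← integral_withDensity_eq_integral_smul measurable_projDensity_mul
      fun w : ℚ_[p] × ℚ_[p] => G (e w.1, e w.2),
    ← integral_withDensity_eq_integral_smul measurable_projDensity_mul, ← projMeasure_prod]
  exact (he.prod he).integral_comp (e.prodCongr e).measurableEmbedding G

theorem ae_notMem_prod {S : Set ℚ_[p]} (hS : S.Finite) :
    ∀ᵐ w ∂(padicHaar₂ p), w.1 ∉ S ∧ w.2 ∉ S := by
  have h : ∀ᵐ x ∂(padicHaar p), x ∉ S := measure_eq_zero_iff_ae_notMem.1 (hS.measure_zero _)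
  exact (Measure.quasiMeasurePreserving_fst.ae h).and (Measure.quasiMeasurePreserving_snd.ae h)

/-- The inner kernel of the triple integral, written with chordal distances. -/
def chordalKernel (α β γ : ℂ) (z : ℚ_[p]) (w : ℚ_[p] × ℚ_[p]) : ℂ :=
  (chordal z w.1 : ℂ) ^ α * (chordal w.1 w.2 : ℂ) ^ β * (chordal z w.2 : ℂ) ^ γ

theorem inv_padicPsi_cpow (x : ℚ_[p]) (s : ℂ) :
    (((padicPsi x)⁻¹ : ℝ) : ℂ) ^ s = (padicPsi x : ℂ) ^ (-s) := by
  have h := ofReal_zpow_cpow (padicPsi_pos x) (-1) s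
  rwa [zpow_neg_one, zpow_neg_one, ← Complex.cpow_neg] at h

theorem chordal_cpow (x y : ℚ_[p]) (s : ℂ) :
    (chordal x y : ℂ) ^ s =
      (‖x - y‖ : ℂ) ^ s * (padicPsi x : ℂ) ^ (-s) * (padicPsi y : ℂ) ^ (-s) := by
  have hx := (inv_pos.2 (padicPsi_pos x)).le
  have hy := (inv_pos.2 (padicPsi_pos y)).le
  rw [chordal, div_eq_mul_inv, mul_inv, ← mul_assoc, Complex.ofReal_mul, Complex.mul_cpow_ofReal_nonneg
    (mul_nonneg (norm_nonneg _) hx) hy, Complex.ofReal_mul, Complex.mul_cpow_ofReal_nonneg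
    (norm_nonneg _) hx, inv_padicPsi_cpow, inv_padicPsi_cpow]

theorem projDensity_smul (x : ℚ_[p]) (s : ℂ) :
    projDensity x • s = (padicPsi x : ℂ) ^ (-2 : ℂ) * s := by
  rw [padicPsi_cpow_neg_two, ← coe_projDensity]
  rfl

theorem padicPsi_cpow_add (x : ℚ_[p]) (s t : ℂ) :
    (padicPsi x : ℂ) ^ (s + t) = (padicPsi x : ℂ) ^ s * (padicPsi x : ℂ) ^ t :=
  Complex.cpow_add _ _ (by exact_mod_cast (padicPsi_pos x).ne')

theorem tripleIntegrand_eq (σ₁ σ₂ σ₃ : ℂ) (z : ℚ_[p]) (w : ℚ_[p] × ℚ_[p]) :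
    tripleIntegrand p σ₁ σ₂ σ₃ (z, w) =
      projDensity z • (projDensity w.1 * projDensity w.2) •
        chordalKernel (-1 - zamNu σ₃ σ₁ σ₂) (-1 - zamNu σ₁ σ₂ σ₃) (-1 - zamNu σ₂ σ₃ σ₁) z w := by
  simp only [tripleIntegrand, chordalKernel, mul_smul, projDensity_smul, chordal_cpow]
  rw [norm_sub_rev w.2 z,
    show -2 * σ₁ = -2 + -(-1 - zamNu σ₃ σ₁ σ₂) + -(-1 - zamNu σ₂ σ₃ σ₁) by
      simp only [zamNu]; ring,
    show -2 * σ₂ = -2 + -(-1 - zamNu σ₃ σ₁ σ₂) + -(-1 - zamNu σ₁ σ₂ σ₃) by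
      simp only [zamNu]; ring,
    show -2 * σ₃ = -2 + -(-1 - zamNu σ₁ σ₂ σ₃) + -(-1 - zamNu σ₂ σ₃ σ₁) by
      simp only [zamNu]; ring]
  simp only [padicPsi_cpow_add]
  ring

/-- In the new coordinates `z` sits at infinity: its two distances become powers of `ψ`, which
combine with the densities into `ψ^(-2σ₂)` and `ψ^(-2σ₃)`. -/
theorem projDensity_smul_chordalKernel_ae_eq (σ₁ σ₂ σ₃ : ℂ) {z : ℚ_[p]} {e : ℚ_[p] ≃ᵐ ℚ_[p]}
    {S : Set ℚ_[p]} (hS : S.Finite) (h1 : ∀ u ∉ S, chordal z (e u) = (padicPsi u)⁻¹)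
    (h2 : ∀ u ∉ S, ∀ v ∉ S, chordal (e u) (e v) = chordal u v) :
    (fun w : ℚ_[p] × ℚ_[p] => (projDensity w.1 * projDensity w.2) •
        chordalKernel (-1 - zamNu σ₃ σ₁ σ₂) (-1 - zamNu σ₁ σ₂ σ₃) (-1 - zamNu σ₂ σ₃ σ₁) z
          (e w.1, e w.2)) =ᵐ[padicHaar₂ p]
      jIntegrand p (-2 * σ₂) (-2 * σ₃) (-1 - zamNu σ₁ σ₂ σ₃) := by
  filter_upwards [ae_notMem_prod hS] with w hw
  simp only [jIntegrand, chordalKernel, mul_smul, projDensity_smul]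
  rw [h1 _ hw.1, h1 _ hw.2, h2 _ hw.1 _ hw.2, chordal_cpow, inv_padicPsi_cpow, inv_padicPsi_cpow,
    show -2 * σ₂ = -2 + -(-1 - zamNu σ₃ σ₁ σ₂) + -(-1 - zamNu σ₁ σ₂ σ₃) by
      simp only [zamNu]; ring,
    show -2 * σ₃ = -2 + -(-1 - zamNu σ₁ σ₂ σ₃) + -(-1 - zamNu σ₂ σ₃ σ₁) by
      simp only [zamNu]; ring]
  simp only [padicPsi_cpow_add]
  ring

theorem projDensity_pos (z : ℚ_[p]) : 0 < projDensity z := by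
  rw [← NNReal.coe_pos, coe_projDensity]
  have := padicPsi_pos z
  positivity

theorem integrable_tripleIntegrand_slice_iff (σ₁ σ₂ σ₃ : ℂ) (z : ℚ_[p]) :
    Integrable (fun w => tripleIntegrand p σ₁ σ₂ σ₃ (z, w)) (padicHaar₂ p) ↔
      Integrable (jIntegrand p (-2 * σ₂) (-2 * σ₃) (-1 - zamNu σ₁ σ₂ σ₃)) (padicHaar₂ p) := by
  obtain ⟨e, S, hS, he, h1, h2⟩ := exists_measurePreserving_chordal z
  rw [← integrable_congr (projDensity_smul_chordalKernel_ae_eq σ₁ σ₂ σ₃ hS h1 h2),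
    integrable_projDensity_smul_comp_iff he]
  simp only [tripleIntegrand_eq]
  exact integrable_smul_iff (c := (projDensity z : ℝ)) (by exact_mod_cast (projDensity_pos z).ne') _

/-- The change of variables holds for Bochner integrals unconditionally: without integrability both
sides are `0`. -/
theorem integral_tripleIntegrand_slice (σ₁ σ₂ σ₃ : ℂ) (z : ℚ_[p]) :
    ∫ w, tripleIntegrand p σ₁ σ₂ σ₃ (z, w) ∂(padicHaar₂ p) =
      projDensity z • jIntegral p (-2 * σ₂) (-2 * σ₃) (-1 - zamNu σ₁ σ₂ σ₃) := by
  obtain ⟨e, S, hS, he, h1, h2⟩ := exists_measurePreserving_chordal z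
  rw [jIntegral, ← integral_congr_ae (projDensity_smul_chordalKernel_ae_eq σ₁ σ₂ σ₃ hS h1 h2),
    integral_projDensity_smul_comp he]
  simp only [tripleIntegrand_eq]
  exact integral_smul (projDensity z : ℝ) _

theorem norm_nnreal_smul {F : Type*} [NormedAddCommGroup F] [NormedSpace ℝ F] (r : ℝ≥0) (x : F) :
    ‖r • x‖ = r • ‖x‖ := by
  rw [NNReal.smul_def, norm_smul, Real.norm_of_nonneg r.coe_nonneg]
  rfl

theorem integral_norm_tripleIntegrand_slice (σ₁ σ₂ σ₃ : ℂ) (z : ℚ_[p]) :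
    ∫ w, ‖tripleIntegrand p σ₁ σ₂ σ₃ (z, w)‖ ∂(padicHaar₂ p) =
      (padicPsi z ^ 2)⁻¹ *
        ∫ w, ‖jIntegrand p (-2 * σ₂) (-2 * σ₃) (-1 - zamNu σ₁ σ₂ σ₃) w‖ ∂(padicHaar₂ p) := by
  obtain ⟨e, S, hS, he, h1, h2⟩ := exists_measurePreserving_chordal z
  have h := (projDensity_smul_chordalKernel_ae_eq σ₁ σ₂ σ₃ hS h1 h2).fun_comp norm
  refine Eq.trans ?_ (congrArg _ (integral_congr_ae h))
  simp only [Function.comp_def, tripleIntegrand_eq, norm_nnreal_smul]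
  rw [integral_projDensity_smul_comp he fun w => ‖chordalKernel _ _ _ z w‖, ← coe_projDensity]
  exact integral_smul (projDensity z : ℝ) _

theorem measurable_tripleIntegrand (σ₁ σ₂ σ₃ : ℂ) : Measurable (tripleIntegrand p σ₁ σ₂ σ₃) := by
  have := measurable_padicPsi (p := p)
  unfold tripleIntegrand
  fun_prop

instance : SFinite (padicHaar₂ p) := by
  unfold padicHaar₂
  infer_instance

theorem integrable_tripleIntegrand_iff_jIntegrand (σ₁ σ₂ σ₃ : ℂ) :
    Integrable (tripleIntegrand p σ₁ σ₂ σ₃) (padicHaar₃ p) ↔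
      Integrable (jIntegrand p (-2 * σ₂) (-2 * σ₃) (-1 - zamNu σ₁ σ₂ σ₃)) (padicHaar₂ p) := by
  have h := integrable_prod_iff (μ := padicHaar p) (ν := padicHaar₂ p)
    (f := tripleIntegrand p σ₁ σ₂ σ₃) (measurable_tripleIntegrand σ₁ σ₂ σ₃).aestronglyMeasurable
  simp only [integrable_tripleIntegrand_slice_iff, Filter.eventually_const,
    integral_norm_tripleIntegrand_slice] at h
  -- The outer condition in Tonelli is automatic, since the norm integrals are a constant times
  -- `ψ⁻²`.
  exact h.trans (and_iff_left (integrable_padicPsi_sq_inv.mul_const _))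

theorem tripleIntegral_eq_jIntegral {σ₁ σ₂ σ₃ : ℂ}
    (h : Integrable (tripleIntegrand p σ₁ σ₂ σ₃) (padicHaar₃ p)) :
    tripleIntegral p σ₁ σ₂ σ₃ =
      (1 + (p : ℂ)⁻¹) * jIntegral p (-2 * σ₂) (-2 * σ₃) (-1 - zamNu σ₁ σ₂ σ₃) := by
  have h1 : ∫ z, (projDensity z : ℝ) ∂(padicHaar p) = 1 + (p : ℝ)⁻¹ := by
    simp only [coe_projDensity, integral_padicPsi_sq_inv]
  refine (integral_prod (μ := padicHaar p) (ν := padicHaar₂ p) _ h).trans ?_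
  simp only [integral_tripleIntegrand_slice, NNReal.smul_def]
  rw [integral_smul_const, h1, Complex.real_smul]
  push_cast
  rfl

theorem convergenceDomain_iff (σ₁ σ₂ σ₃ : ℂ) :
    ConvergenceDomain σ₁ σ₂ σ₃ ↔
      0 < (-1 - zamNu σ₁ σ₂ σ₃ + 1).re ∧
      0 < (-(-2 * σ₂) - (-1 - zamNu σ₁ σ₂ σ₃) - 1).re ∧
      0 < (-(-2 * σ₃) - (-1 - zamNu σ₁ σ₂ σ₃) - 1).re ∧
      0 < (-(-2 * σ₂) - (-2 * σ₃) - (-1 - zamNu σ₁ σ₂ σ₃) - 2).re := by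
  simp only [ConvergenceDomain, zamNu, Complex.add_re, Complex.sub_re, Complex.neg_re,
    Complex.one_re, Complex.re_ofNat, Complex.mul_re, Complex.neg_im, Complex.im_ofNat]
  constructor
  · rintro ⟨h1, h2, h3, h4⟩
    refine ⟨?_, ?_, ?_, ?_⟩ <;> linarith
  · rintro ⟨h1, h2, h3, h4⟩
    refine ⟨?_, ?_, ?_, ?_⟩ <;> linarith

/-- Sending `x₁` to infinity leaves a double integral in `x₂, x₃`, whereas `doubleIntegral` has `x₁,
x₂`. Cyclic symmetry identifies the two. -/
theorem convergenceDomain_rotate {σ₁ σ₂ σ₃ : ℂ} :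
    ConvergenceDomain σ₁ σ₂ σ₃ ↔ ConvergenceDomain σ₃ σ₁ σ₂ := by
  simp only [ConvergenceDomain, show σ₃ + σ₁ + σ₂ = σ₁ + σ₂ + σ₃ by ring]
  tauto

theorem jIntegral_eq_of_convergenceDomain {σ₁ σ₂ σ₃ : ℂ} (h : ConvergenceDomain σ₁ σ₂ σ₃) :
    jIntegral p (-2 * σ₂) (-2 * σ₃) (-1 - zamNu σ₁ σ₂ σ₃) =
      padicGamma p (σ₁ + σ₂ + σ₃ - 1) *
        (padicGamma p (-zamNu σ₁ σ₂ σ₃) * padicGamma p (-zamNu σ₂ σ₃ σ₁) *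
          padicGamma p (-zamNu σ₃ σ₁ σ₂)) /
        (padicGamma p (2 * σ₁) * padicGamma p (2 * σ₂) * padicGamma p (2 * σ₃)) := by
  obtain ⟨h1, h2, h3, h4⟩ := (convergenceDomain_iff σ₁ σ₂ σ₃).1 h
  rw [jIntegral_eq h1 h2 h3 h4,
    show -1 - zamNu σ₁ σ₂ σ₃ + 1 = -zamNu σ₁ σ₂ σ₃ by ring,
    show -(-2 * σ₂) - (-1 - zamNu σ₁ σ₂ σ₃) - 1 = -zamNu σ₃ σ₁ σ₂ by simp only [zamNu]; ring,
    show -(-2 * σ₃) - (-1 - zamNu σ₁ σ₂ σ₃) - 1 = -zamNu σ₂ σ₃ σ₁ by simp only [zamNu]; ring,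
    show -(-2 * σ₂) - (-2 * σ₃) - (-1 - zamNu σ₁ σ₂ σ₃) - 2 = σ₁ + σ₂ + σ₃ - 1 by
      simp only [zamNu]; ring,
    show -(-2 * σ₂) - (-2 * σ₃) - 2 * (-1 - zamNu σ₁ σ₂ σ₃) - 2 = 2 * σ₁ by
      simp only [zamNu]; ring, neg_mul, neg_neg, neg_mul, neg_neg]
  ring

theorem one_div_padicGamma_two : 1 / padicGamma p 2 = 1 + (p : ℂ)⁻¹ := by
  have h : (p : ℂ) ^ (-2 : ℂ) = (p : ℂ)⁻¹ * (p : ℂ)⁻¹ := by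
    rw [Complex.cpow_neg, show (2 : ℂ) = ((2 : ℕ) : ℂ) by norm_num, Complex.cpow_natCast, sq,
      mul_inv]
  rw [padicGamma, one_div_div, h, div_eq_iff one_sub_inv_prime_ne_zero]
  ring

end TripleIntegral

end

theorem theorem1p9 (p : ℕ) [Fact p.Prime] :
    -- the constant: `1 / Γ_{ℚ_p}(2) = ∫ ψ_p⁻² = 1 + p⁻¹`
    (Integrable (fun x : ℚ_[p] => (padicPsi x ^ 2)⁻¹) (padicHaar p) ∧
      ∫ x : ℚ_[p], (padicPsi x ^ 2)⁻¹ ∂(padicHaar p) = 1 + (p : ℝ)⁻¹ ∧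
      1 / padicGamma p 2 = 1 + (p : ℂ)⁻¹) ∧
    -- the exact domain of absolute convergence, and on it the two formulas
    (∀ σ₁ σ₂ σ₃ : ℂ,
      (Integrable (tripleIntegrand p σ₁ σ₂ σ₃) (padicHaar₃ p) ↔ ConvergenceDomain σ₁ σ₂ σ₃) ∧
      (Integrable (doubleIntegrand p σ₁ σ₂ σ₃) (padicHaar₂ p) ↔ ConvergenceDomain σ₁ σ₂ σ₃) ∧
      (ConvergenceDomain σ₁ σ₂ σ₃ →
        tripleIntegral p σ₁ σ₂ σ₃ = 1 / padicGamma p 2 * doubleIntegral p σ₁ σ₂ σ₃ ∧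
        doubleIntegral p σ₁ σ₂ σ₃ =
          padicGamma p (σ₁ + σ₂ + σ₃ - 1) *
            (padicGamma p (-zamNu σ₁ σ₂ σ₃) * padicGamma p (-zamNu σ₂ σ₃ σ₁) *
              padicGamma p (-zamNu σ₃ σ₁ σ₂)) /
            (padicGamma p (2 * σ₁) * padicGamma p (2 * σ₂) * padicGamma p (2 * σ₃)))) ∧
    -- the equivalent form of the second formula in the parameters `a, b, c`
    (∀ a b c : ℂ,
      (Integrable (jIntegrand p a b c) (padicHaar₂ p) ↔
        0 < (c + 1).re ∧ 0 < (-a - c - 1).re ∧ 0 < (-b - c - 1).re ∧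
          0 < (-a - b - c - 2).re) ∧
      (0 < (c + 1).re → 0 < (-a - c - 1).re → 0 < (-b - c - 1).re →
          0 < (-a - b - c - 2).re →
        jIntegral p a b c =
          padicGamma p (c + 1) * padicGamma p (-a - c - 1) * padicGamma p (-b - c - 1) *
              padicGamma p (-a - b - c - 2) /
            (padicGamma p (-a) * padicGamma p (-b) * padicGamma p (-a - b - 2 * c - 2)))) := by
  refine ⟨⟨integrable_padicPsi_sq_inv, integral_padicPsi_sq_inv, one_div_padicGamma_two⟩,
    fun σ₁ σ₂ σ₃ => ?_, fun a b c => ⟨integrable_jIntegrand_iff a b c, jIntegral_eq⟩⟩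
  have htriple : Integrable (tripleIntegrand p σ₁ σ₂ σ₃) (padicHaar₃ p) ↔
      ConvergenceDomain σ₁ σ₂ σ₃ := by
    rw [integrable_tripleIntegrand_iff_jIntegrand, integrable_jIntegrand_iff, convergenceDomain_iff]
  refine ⟨htriple, ?_, fun h => ?_⟩
  · rw [convergenceDomain_rotate, convergenceDomain_iff, ← integrable_jIntegrand_iff (p := p)]
    -- `doubleIntegrand p σ₁ σ₂ σ₃` is by definition `jIntegrand` with parameters `-2 * σ₁`, `-2 *
    -- σ₂`, `-1 - zamNu σ₃ σ₁ σ₂`.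
    rfl
  · have hdouble : doubleIntegral p σ₁ σ₂ σ₃ =
        padicGamma p (σ₁ + σ₂ + σ₃ - 1) *
          (padicGamma p (-zamNu σ₁ σ₂ σ₃) * padicGamma p (-zamNu σ₂ σ₃ σ₁) *
            padicGamma p (-zamNu σ₃ σ₁ σ₂)) /
          (padicGamma p (2 * σ₁) * padicGamma p (2 * σ₂) * padicGamma p (2 * σ₃)) := by
      refine (jIntegral_eq_of_convergenceDomain (convergenceDomain_rotate.1 h)).trans ?_
      rw [show σ₃ + σ₁ + σ₂ - 1 = σ₁ + σ₂ + σ₃ - 1 by ring]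
      ring
    refine ⟨?_, hdouble⟩
    rw [tripleIntegral_eq_jIntegral (htriple.2 h), jIntegral_eq_of_convergenceDomain h, hdouble,
      one_div_padicGamma_two]
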